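/- **Setting.** Let $\ell:\mathbb R^d\times\mathcal Z\to\mathbb R$ be jointly measurable and differentiable in $w$, let $\mathcal D$ be a probability law on $\mathcal Z$, and suppose that for every $w$ the variable $\ell(w,Z)$, $Z\sim\mathcal D$, is $R$-sub-Gaussian: $\mathbb E\,e^{\lambda(\ell(w,Z)-\mathbb E\ell(w,Z))}\le e^{\lambda^2R^2/2}$ for all $\lambda\in\mathbb R$. Put $g(w,z)=\nabla_w\ell(w,z)$ and $\bar g(w)=\mathbb E_{Z\sim\mathcal D}\,g(w,Z)$ (assumed to exist), and $L(w,s)=\frac1n\sum_{i=1}^n\ell(w,z_i)$ for $s=(z_1,\dots,z_n)$, $n\ge1$. On a probability space let $S=(Z_1,\dots,Z_n)$ and $S'=(Z_1',\dots,Z_n')$ be i.i.d. samples from $\mathcal D$. SGD starts at a random $W_1$ and performs, for $t=1,\dots,T-1$, $$W_{t+1}=W_t-\eta_tG_t,\qquad G_t=\frac1{|J_t|}\sum_{i\in J_t}g(W_t,Z_i),$$ with rates $\eta_t>0$ and nonempty random index sets $J_t\subseteq\{1,\dots,n\}$; $B_t=(Z_i)_{i\in J_t}$. The real history is $\mathcal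 H_r=\sigma(W_1,\dots,W_{r+1},J_1,\dots,J_r,B_1,\dots,B_r,G_1,\dots,G_r)$. Let $\mathcal U$ be a sigma-field (auxiliary randomness) such that $\sigma(W_1)\vee\mathcal U$ is independent of $S$. For each $t$ let $\Sigma_t$ be an $\mathcal H_{t-1}$-measurable random matrix, a.s. positive definite. The virtual path is $\widetilde W_1=W_1$, $\widetilde W_{t+1}=\widetilde W_t-\eta_tG_t+\varepsilon_t$, where $$\varepsilon_t\mid \mathcal H_{T-1}\vee\sigma(S)\vee\mathcal U\vee\sigma(\varepsilon_1,\dots,\varepsilon_{t-1})\ \sim\ \mathcal N(0,\Sigma_t),\qquad t=1,\dots,T-1.$$ The ghost sample $S'$ is independent of $\sigma(S)\vee\mathcal H_{T-1}\vee\sigma(\varepsilon_1,\dots,\varepsilon_{T-1})\vee\mathcal U$. Write $\xi_t=\widetilde W_t-W_t$, $\Sigma_{1:t}=\sum_{k<t}\Sigma_k$, $\|x\|_M^2=x^\top Mx$, and $$V_t^{\rm ad}=\mathbb E\big[\|G_t-\bar g(W_t)\|^2_{\Sigma_t^{-1}}\mid\mathcal H_{t-1}\vee\mathcal U\big],\qquad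 \Gamma_t^{\rm ad}=\mathbb E\big[\|\bar g(W_t+\xi_t)-\bar g(W_t)\|^2_{\Sigma_t^{-1}}\mid\mathcal H_{t-1}\vee\mathcal U\big],$$ $$\Delta_C(w,s)=\mathbb E_{\zeta\sim\mathcal N(0,C)}[L(w,s)-L(w+\zeta,s)],\qquad \mathcal R_\Delta(C)=\big|\mathbb E[\Delta_C(W_T,S')-\Delta_C(W_T,S)]\big|,$$ $\mathcal R_\Delta^{\rm ad}=\mathcal R_\Delta(\Sigma_{1:T})$ and $\mathrm{gen}(W_T,S)=\mathbb E[L(W_T,S')-L(W_T,S)]$. Assume that $\mathbb E V_t^{\rm ad}$, $\mathbb E\Gamma_t^{\rm ad}$ are finite, that $\Delta_{\Sigma_{1:T}}(W_T,S)$ and $\Delta_{\Sigma_{1:T}}(W_T,S')$ are a.s. well defined (absolutely convergent), and that their difference is integrable. Let $\mathcal F_t^Q=\sigma(\widetilde W_1,\dots,\widetilde W_t)\vee\mathcal U$. A *synchronized reference* at time $t$ is an $\mathcal F_t^Q$-measurable, a.s. positive definite random matrix $\Sigma_t^{\rm sync}$ with $\Sigma_t^{\rm sync}=\Sigma_t$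 a.s. For a reference covariance $\Sigma_t^{\rm ref}$ put $\Lambda_t=(\Sigma_t^{\rm ref})^{-1}$ and $\mathcal C_t^{\rm cov}=\frac12\mathbb E\big[\mathrm{Tr}(\Lambda_t\Sigma_t)-d+\log\frac{\det\Sigma_t^{\rm ref}}{\det\Sigma_t}\big]$. **Claim.** 1. Suppose a synchronized reference exists at every $t=1,\dots,T-1$. Then for every choice $\Sigma_t^{\rm ref}=\Sigma_t^{\rm sync}$ one has $\mathcal C_t^{\rm cov}=0$ and $\Lambda_t=\Sigma_t^{-1}$ a.s.; moreover $L(W_T,S')-L(W_T,S)$ is integrable and $$|\mathrm{gen}(W_T,S)|\le\sqrt{\frac{4R^2}{n}\sum_{t=1}^{T-1}\eta_t^2\,\mathbb E\big[V_t^{\rm ad}+\Gamma_t^{\rm ad}\big]}+\mathcal R_\Delta^{\rm ad}.$$ 2. Any version of $\Sigma_t$ that is deterministic, or $\mathcal U$-measurable (public), or $\mathcal F_t^Q$-measurable (prefix-observable) is a synchronized reference at $t$. 3. (Fixed geometry.) If $\Sigma_t=C_t$ a.s. with deterministic $C_t$, then, with $C_{1:t}=\sum_{k<t}C_k$, $$|\mathrm{gen}(W_T,S)|\le\sqrt{\frac{4R^2}{n}\sum_{t=1}^{T-1}\eta_t^2\,\mathbb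 E\Big[\mathbb E\big[\|G_t-\bar g(W_t)\|^2_{C_t^{-1}}\mid\mathcal H_{t-1}\big]+\Gamma_{C_t,C_{1:t}}(W_t)\Big]}+\mathcal R_\Delta(C_{1:T}),$$ where $\Gamma_{C,C'}(w)=\mathbb E_{\zeta\sim\mathcal N(0,C')}\|\bar g(w+\zeta)-\bar g(w)\|^2_{C^{-1}}$. 4. (Fixed isotropic.) If $\Sigma_t=\sigma_t^2I$ a.s. with deterministic $\sigma_t>0$, then, with $\sigma_{1:t}^2=\sum_{k<t}\sigma_k^2$, $$|\mathrm{gen}(W_T,S)|\le\sqrt{\frac{4R^2}{n}\sum_{t=1}^{T-1}\frac{\eta_t^2}{\sigma_t^2}\,\mathbb E\Big[\mathbb E\big[\|G_t-\bar g(W_t)\|^2\mid\mathcal H_{t-1}\big]+\mathbb E_{\zeta\sim\mathcal N(0,\sigma_{1:t}^2I)}\|\bar g(W_t+\zeta)-\bar g(W_t)\|^2\Big]}+\mathcal R_\Delta(\sigma_{1:T}^2I).$$ -/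

import Mathlib

open MeasureTheory ProbabilityTheory
open scoped NNReal

/-- The parameter space `ℝ^d` with its Euclidean norm. -/
abbrev Param (d : ℕ) : Type := EuclideanSpace ℝ (Fin d)

/-- The squared norm `‖x‖²_M = xᵀ M x`. -/
noncomputable def sqNormIn {d : ℕ} (M : Matrix (Fin d) (Fin d) ℝ) (x : Param d) : ℝ :=
  x.ofLp ⬝ᵥ (M.mulVec x.ofLp)

/-- A random matrix is `m`-measurable when all its entries are. -/
def MatrixMeasurable {Ω : Type*} {d : ℕ} (m : MeasurableSpace Ω)
    (M : Ω → Matrix (Fin d) (Fin d) ℝ) : Prop :=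
  ∀ i j, Measurable[m] fun ω => M ω i j

/-- `X ∣ m ∼ κ`: the random measure `κ` is a conditional law of `X` given the sigma-field `m`,
that is, `P(X ∈ A ∣ m) = κ(A)` almost surely for every measurable set `A`. -/
def HasCondLaw {Ω E : Type*} [MeasurableSpace Ω] [MeasurableSpace E] (μ : Measure Ω)
    (m : MeasurableSpace Ω) (X : Ω → E) (κ : Ω → Measure E) : Prop :=
  ∀ A : Set E, MeasurableSet A →
    μ[(X ⁻¹' A).indicator (fun _ => (1 : ℝ)) | m] =ᵐ[μ] fun ω => (κ ω).real A

/-- The sample gradient `g(w, z) = ∇_w ℓ(w, z)`. -/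
noncomputable def sampleGrad {𝒵 : Type*} {d : ℕ} (loss : Param d → 𝒵 → ℝ)
    (w : Param d) (z : 𝒵) : Param d :=
  gradient (fun v => loss v z) w

/-- The population gradient `ḡ(w) = E_{Z ∼ D} g(w, Z)`. -/
noncomputable def popGrad {𝒵 : Type*} [MeasurableSpace 𝒵] {d : ℕ} (loss : Param d → 𝒵 → ℝ)
    (D : Measure 𝒵) (w : Param d) : Param d :=
  ∫ z, sampleGrad loss w z ∂D

/-- The minibatch gradient `(1 / |J|) ∑_{i ∈ J} g(w, z_i)`. -/
noncomputable def minibatchGrad {𝒵 : Type*} {d n : ℕ} (loss : Param d → 𝒵 → ℝ)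
    (w : Param d) (J : Finset (Fin n)) (s : Fin n → 𝒵) : Param d :=
  (J.card : ℝ)⁻¹ • ∑ i ∈ J, sampleGrad loss w (s i)

/-- The empirical risk `L(w, s) = (1 / n) ∑_i ℓ(w, z_i)`. -/
noncomputable def empRisk {𝒵 : Type*} {d n : ℕ} (loss : Param d → 𝒵 → ℝ)
    (w : Param d) (s : Fin n → 𝒵) : ℝ :=
  (1 / (n : ℝ)) * ∑ i, loss w (s i)

/-- Output sensitivity in a given geometry:
`Δ_C(w, s) = E_{ζ ∼ N(0, C)} [L(w, s) - L(w + ζ, s)]`. -/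
noncomputable def outputSensitivity {𝒵 : Type*} {d n : ℕ} (loss : Param d → 𝒵 → ℝ)
    (C : Matrix (Fin d) (Fin d) ℝ) (w : Param d) (s : Fin n → 𝒵) : ℝ :=
  ∫ x, (empRisk loss w s - empRisk loss (w + x) s) ∂(multivariateGaussian 0 C)

/-- The fresh-copy gradient sensitivity of the population gradient,
`E_{ζ ∼ N(0, C)} ‖ḡ(w + ζ) - ḡ(w)‖²_M`. -/
noncomputable def freshSensitivity {𝒵 : Type*} [MeasurableSpace 𝒵] {d : ℕ}
    (loss : Param d → 𝒵 → ℝ) (D : Measure 𝒵) (M C : Matrix (Fin d) (Fin d) ℝ)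
    (w : Param d) : ℝ :=
  ∫ x, sqNormIn M (popGrad loss D (w + x) - popGrad loss D w) ∂(multivariateGaussian 0 C)

/-- The data of SGD with virtual perturbations, on a probability space `Ω`. Time is counted from
zero: there are `N` updates, update `t ∈ {0, …, N - 1}` leads from iterate `t` to iterate `t + 1`,
iterate `0` is the initialization and iterate `N` is the output. -/
structure VirtualSGD (Ω 𝒵 : Type*) (d n N : ℕ) where
  /-- the loss `ℓ(w, z)` -/
  loss : Param d → 𝒵 → ℝ
  /-- the training sample -/
  sample : Ω → Fin n → 𝒵
  /-- the ghost sample -/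
  ghost : Ω → Fin n → 𝒵
  /-- the initial iterate -/
  init : Ω → Param d
  /-- the minibatch index sets -/
  batch : ℕ → Ω → Finset (Fin n)
  /-- the learning rates -/
  rate : ℕ → ℝ
  /-- the covariances of the virtual perturbations -/
  cov : ℕ → Ω → Matrix (Fin d) (Fin d) ℝ
  /-- the virtual perturbations -/
  noise : ℕ → Ω → Param d
  /-- the sigma-field of public, auxiliary or ghost randomness -/
  aux : MeasurableSpace Ω

namespace VirtualSGD

section Paths

variable {Ω 𝒵 : Type*} {d n N : ℕ} (P : VirtualSGD Ω 𝒵 d n N)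

/-- The SGD iterates `W_{t+1} = W_t - η_t G_t`. -/
noncomputable def iter : ℕ → Ω → Param d
  | 0 => P.init
  | t + 1 => fun ω =>
      iter t ω - P.rate t • minibatchGrad P.loss (iter t ω) (P.batch t ω) (P.sample ω)

/-- The stochastic gradient `G_t = g(W_t, B_t)`. -/
noncomputable def stochGrad (t : ℕ) (ω : Ω) : Param d :=
  minibatchGrad P.loss (P.iter t ω) (P.batch t ω) (P.sample ω)

/-- The virtual path `W̃_{t+1} = W̃_t - η_t G_t + ε_t`, started at `W̃_0 = W_0`. -/
noncomputable def virt : ℕ → Ω → Param d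
  | 0 => P.init
  | t + 1 => fun ω => virt t ω - P.rate t • P.stochGrad t ω + P.noise t ω

/-- The accumulated virtual perturbation `ξ_t = W̃_t - W_t`. -/
noncomputable def accNoise (t : ℕ) (ω : Ω) : Param d := P.virt t ω - P.iter t ω

/-- The accumulated covariance: the sum of the covariances of the first `t` perturbations. -/
noncomputable def accCov (t : ℕ) (ω : Ω) : Matrix (Fin d) (Fin d) ℝ :=
  ∑ k ∈ Finset.range t, P.cov k ω

/-- The minibatch `B_t = (Z_i)_{i ∈ J_t}`, together with its index set. -/
def minibatch (t : ℕ) (ω : Ω) : Σ J : Finset (Fin n), (J → 𝒵) :=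
  ⟨P.batch t ω, fun i => P.sample ω i⟩

end Paths

section Probability

variable {Ω 𝒵 : Type*} [MeasurableSpace Ω] [MeasurableSpace 𝒵] {d n N : ℕ}
  (P : VirtualSGD Ω 𝒵 d n N) (μ : Measure Ω) (D : Measure 𝒵)

/-- The real history `H_r` after `r` updates: the sigma-field of the iterates `0, …, r` and of the
index sets, minibatches and stochastic gradients of the first `r` updates. -/
@[reducible] noncomputable def history (r : ℕ) : MeasurableSpace Ω :=
  (⨆ t ∈ Finset.range (r + 1), MeasurableSpace.comap (P.iter t) inferInstance) ⊔
    ⨆ t ∈ Finset.range r,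
      (MeasurableSpace.comap (P.batch t) inferInstance ⊔
        MeasurableSpace.comap (P.minibatch t) inferInstance ⊔
        MeasurableSpace.comap (P.stochGrad t) inferInstance)

/-- The sigma-field of the first `r` virtual perturbations. -/
@[reducible] noncomputable def noiseField (r : ℕ) : MeasurableSpace Ω :=
  ⨆ t ∈ Finset.range r, MeasurableSpace.comap (P.noise t) inferInstance

/-- The sigma-field of the training sample. -/
@[reducible] def sampleField : MeasurableSpace Ω := MeasurableSpace.comap P.sample inferInstance

/-- The reference-visible sigma-field `σ(W̃_0, …, W̃_t) ∨ 𝒰`. -/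
@[reducible] noncomputable def refField (t : ℕ) : MeasurableSpace Ω :=
  (⨆ k ∈ Finset.range (t + 1), MeasurableSpace.comap (P.virt k) inferInstance) ⊔ P.aux

/-- The gradient-deviation term
`V_t(Λ) = E[‖G_t - ḡ(W_t)‖²_Λ ∣ H ∨ 𝒰]`, with `H` the real history before update `t`. -/
noncomputable def gradDeviation (Λ : Ω → Matrix (Fin d) (Fin d) ℝ) (t : ℕ) : Ω → ℝ :=
  μ[fun ω => sqNormIn (Λ ω) (P.stochGrad t ω - popGrad P.loss D (P.iter t ω)) |
    P.history t ⊔ P.aux]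

/-- The gradient-sensitivity term
`Γ_t(Λ) = E[‖ḡ(W_t + ξ_t) - ḡ(W_t)‖²_Λ ∣ H ∨ 𝒰]`, with `H` the real history before update `t`. -/
noncomputable def gradSensitivity (Λ : Ω → Matrix (Fin d) (Fin d) ℝ) (t : ℕ) : Ω → ℝ :=
  μ[fun ω => sqNormIn (Λ ω)
      (popGrad P.loss D (P.iter t ω + P.accNoise t ω) - popGrad P.loss D (P.iter t ω)) |
    P.history t ⊔ P.aux]

/-- The precision `Σ_t⁻¹` of the actual virtual perturbation. -/
noncomputable def precision (t : ℕ) (ω : Ω) : Matrix (Fin d) (Fin d) ℝ := (P.cov t ω)⁻¹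

/-- The covariance-comparison cost at time `t` of a reference covariance `M`. -/
noncomputable def covCost (t : ℕ) (M : Ω → Matrix (Fin d) (Fin d) ℝ) : ℝ :=
  (1 / 2) * ∫ ω, (((M ω)⁻¹ * P.cov t ω).trace - (d : ℝ)
    + Real.log ((M ω).det / (P.cov t ω).det)) ∂μ

/-- The expected generalization error `gen(W, S) = E[L(W, S') - L(W, S)]` of the SGD output. -/
noncomputable def genError : ℝ :=
  ∫ ω, (empRisk P.loss (P.iter N ω) (P.ghost ω) -
    empRisk P.loss (P.iter N ω) (P.sample ω)) ∂μ

/-- `|E[Δ_C(W, S') - Δ_C(W, S)]|`, where `W` is the SGD output and the geometry `C` may be random.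
Given the real history, `C` and `W` are fixed and the perturbation inside `Δ_C` is a fresh `N(0, C)`
vector. -/
noncomputable def outputPenalty (C : Ω → Matrix (Fin d) (Fin d) ℝ) : ℝ :=
  |∫ ω, (outputSensitivity P.loss (C ω) (P.iter N ω) (P.ghost ω) -
    outputSensitivity P.loss (C ω) (P.iter N ω) (P.sample ω)) ∂μ|

/-- An admissible synchronized reference at time `t`: a version of the actual covariance that is
positive definite and measurable with respect to the reference-visible sigma-field. -/
structure IsSyncReference (t : ℕ) (M : Ω → Matrix (Fin d) (Fin d) ℝ) : Prop where
  measurable : MatrixMeasurable (P.refField t) M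
  posDef : ∀ᵐ ω ∂μ, (M ω).PosDef
  eq_cov : ∀ᵐ ω ∂μ, M ω = P.cov t ω

/-- The standing assumptions on data, loss, SGD and virtual perturbations. -/
structure Conditions (R : ℝ≥0) : Prop where
  /-- the sample is not empty -/
  size_pos : 0 < n
  measurable_loss : Measurable (Function.uncurry P.loss)
  measurable_sample : Measurable P.sample
  measurable_ghost : Measurable P.ghost
  measurable_init : Measurable P.init
  measurable_batch : ∀ t < N, Measurable (P.batch t)
  measurable_noise : ∀ t < N, Measurable (P.noise t)
  aux_le : P.aux ≤ ‹MeasurableSpace Ω›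
  /-- the sample is i.i.d. with law `D` -/
  law_sample : μ.map P.sample = Measure.pi fun _ => D
  /-- the ghost sample is i.i.d. with law `D` -/
  law_ghost : μ.map P.ghost = Measure.pi fun _ => D
  /-- the ghost sample is independent of everything else -/
  indep_ghost : Indep (P.sampleField ⊔ P.history N ⊔ P.noiseField N ⊔ P.aux)
    (MeasurableSpace.comap P.ghost inferInstance) μ
  /-- initialization and auxiliary randomness are independent of the sample -/
  indep_init_aux : Indep (MeasurableSpace.comap P.init inferInstance ⊔ P.aux) P.sampleField μ
  /-- minibatches are not empty -/
  batch_nonempty : ∀ t < N, ∀ ω, (P.batch t ω).Nonempty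
  rate_pos : ∀ t < N, 0 < P.rate t
  /-- the loss is differentiable in the parameter -/
  differentiable_loss : ∀ z, Differentiable ℝ fun w => P.loss w z
  /-- the population gradient exists -/
  integrable_grad : ∀ w, Integrable (sampleGrad P.loss w) D
  /-- the loss is `R`-sub-Gaussian at each parameter -/
  subGaussian_loss : ∀ w, HasSubgaussianMGF (fun z => P.loss w z - ∫ z', P.loss w z' ∂D) (R ^ 2) D
  /-- the covariances are predictable -/
  predictable_cov : ∀ t < N, MatrixMeasurable (P.history t) (P.cov t)
  posDef_cov : ∀ t < N, ∀ᵐ ω ∂μ, (P.cov t ω).PosDef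
  /-- given the whole real history, the sample and the auxiliary randomness, the perturbations are
  conditionally independent and centered Gaussian with covariances `Σ_t` -/
  law_noise : ∀ t < N,
    HasCondLaw μ (P.history N ⊔ P.sampleField ⊔ P.aux ⊔ P.noiseField t) (P.noise t)
      fun ω => multivariateGaussian 0 (P.cov t ω)
  /-- the gradient-deviation terms are finite -/
  integrable_deviation : ∀ t < N, Integrable (fun ω =>
    sqNormIn (P.precision t ω) (P.stochGrad t ω - popGrad P.loss D (P.iter t ω))) μ
  /-- the gradient-sensitivity terms are finite -/
  integrable_sensitivity : ∀ t < N, Integrable (fun ω =>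
    sqNormIn (P.precision t ω)
      (popGrad P.loss D (P.iter t ω + P.accNoise t ω) - popGrad P.loss D (P.iter t ω))) μ
  /-- the output sensitivities at the two samples are finite -/
  integrable_output_sample : ∀ᵐ ω ∂μ, Integrable
    (fun x => empRisk P.loss (P.iter N ω) (P.sample ω) -
      empRisk P.loss (P.iter N ω + x) (P.sample ω)) (multivariateGaussian 0 (P.accCov N ω))
  integrable_output_ghost : ∀ᵐ ω ∂μ, Integrable
    (fun x => empRisk P.loss (P.iter N ω) (P.ghost ω) -
      empRisk P.loss (P.iter N ω + x) (P.ghost ω)) (multivariateGaussian 0 (P.accCov N ω))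
  /-- the output penalty is finite -/
  integrable_penalty : Integrable (fun ω =>
    outputSensitivity P.loss (P.accCov N ω) (P.iter N ω) (P.ghost ω) -
      outputSensitivity P.loss (P.accCov N ω) (P.iter N ω) (P.sample ω)) μ

end Probability

end VirtualSGD

/-! The proof is a change of measure in the style of Girsanov, followed by the Donsker–Varadhan
inequality.

At time t the virtual path moves by `-η_t G_t + ε_t`. Tilting the law of `ε_t` by the exponential
martingale in direction `Σ_t⁻¹ η_t (G_t - ḡ(W̃_t))` shifts its conditional mean so that `G_t` is
replaced by `ḡ(W̃_t)` (`lintegral_ratio_succ`). Under the tilted measure the virtual path is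
therefore a chain driven by the population gradient, with transition `N(W̃_t - η_t ḡ(W̃_t), Σ_t)`.
The training sample could still enter through `Σ_t`; a synchronized reference excludes this, since
it is a version of `Σ_t` that the reference sigma-field sees. By induction on t the reference
sigma-field is then independent of the sample, whose law is unchanged (`trim_refMeasure_restrict`).

Under the tilted measure the centered empirical risk at the virtual output is thus an average of n
independent sub-Gaussian variables for frozen parameter. The relative entropy of the true law
against the tilted one is minus the mean log ratio, that is, half the expected energy of the tilts;
this is at most `∑ η_t² E[V_t + Γ_t]` by splitting `G_t - ḡ(W̃_t)` at `ḡ(W_t)`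
(`integrable_logRatio`). The variational inequality turns both facts into a bound at the virtual
output (`virtual_bound`). The ghost sample is independent of the virtual output already under the
true law, so its centered risk has mean zero.

It remains to return to the real output. Given the history, both samples and the auxiliary
randomness, `W̃_N - W_N` is Gaussian with covariance the sum of the `Σ_t`
(`hasCondDistrib_accNoise`), because predictable covariances are frozen by the whole history.
Averaging over it converts the virtual gap into the real gap minus the output-sensitivity difference
(`integral_output`). Fixed and isotropic covariances are instances, since constants are
synchronized. -/

set_option linter.unusedSectionVars false

/-! ### Gaussian measures: dependence on the covariance, convolution, exponential tilting. -/

section Gaussian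

open Matrix
open scoped MatrixOrder Matrix.Norms.L2Operator RealInnerProductSpace ENNReal

variable {d : ℕ}

instance Matrix.instMeasurableSpaceFinReal : MeasurableSpace (Matrix (Fin d) (Fin d) ℝ) :=
  inferInstanceAs (MeasurableSpace (Fin d → Fin d → ℝ))

instance Matrix.instBorelSpaceFinReal : BorelSpace (Matrix (Fin d) (Fin d) ℝ) :=
  inferInstanceAs (BorelSpace (Fin d → Fin d → ℝ))

lemma Matrix.isClosed_setOf_posSemidef :
    IsClosed {A : Matrix (Fin d) (Fin d) ℝ | A.PosSemidef} := by
  have : {A : Matrix (Fin d) (Fin d) ℝ | A.PosSemidef} =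
      {A | Aᴴ = A} ∩ ⋂ x : Fin d → ℝ, {A | 0 ≤ star x ⬝ᵥ (A *ᵥ x)} := by
    ext A
    simp only [Set.mem_ofPred_eq, Set.mem_inter_iff, Set.mem_iInter]
    exact Matrix.posSemidef_iff_dotProduct_mulVec
  rw [this]
  refine (isClosed_eq (by fun_prop) continuous_id).inter (isClosed_iInter fun x => ?_)
  refine isClosed_le continuous_const ?_
  exact (continuous_const.dotProduct (continuous_id.matrix_mulVec continuous_const))

/-- The square root is continuous on the closed cone of positive semidefinite matrices and takes the
default value 0 off it. -/
lemma Matrix.measurable_sqrt :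
    Measurable (CFC.sqrt : Matrix (Fin d) (Fin d) ℝ → Matrix (Fin d) (Fin d) ℝ) := by
  have hs : MeasurableSet {A : Matrix (Fin d) (Fin d) ℝ | A.PosSemidef} :=
    Matrix.isClosed_setOf_posSemidef.measurableSet
  classical
  have h0 : (CFC.sqrt : Matrix (Fin d) (Fin d) ℝ → Matrix (Fin d) (Fin d) ℝ) =
      {A : Matrix (Fin d) (Fin d) ℝ | A.PosSemidef}.piecewise CFC.sqrt 0 := by
    ext1 A
    by_cases hA : A.PosSemidef
    · rw [Set.piecewise_eq_of_mem _ _ _ (by exact hA)]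
    · rw [Set.piecewise_eq_of_notMem _ _ _ (by exact hA), CFC.sqrt, cfcₙ_apply_of_not_predicate]
      · rfl
      · change ¬ (A - 0).PosSemidef
        simpa
  rw [h0]
  have hc : ContinuousOn (CFC.sqrt : Matrix (Fin d) (Fin d) ℝ → _) {A | A.PosSemidef} := by
    have := CFC.continuousOn_sqrt (A := Matrix (Fin d) (Fin d) ℝ)
    simpa only [Matrix.nonneg_iff_posSemidef] using this
  exact hc.measurable_piecewise continuousOn_const hs

/-- All these laws are images of one standard Gaussian under `x ↦ √S x`, so the mass of a set is the
standard Gaussian mass of a section of a jointly measurable set. -/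
lemma measurable_multivariateGaussian :
    Measurable fun S : Matrix (Fin d) (Fin d) ℝ => multivariateGaussian (0 : Param d) S := by
  have hc : Continuous fun p : Matrix (Fin d) (Fin d) ℝ × Param d =>
      (WithLp.toLp 2 (p.1 *ᵥ p.2.ofLp) : Param d) :=
    (PiLp.continuous_toLp 2 _).comp
      (continuous_fst.matrix_mulVec ((PiLp.continuous_ofLp 2 _).comp continuous_snd))
  have hq : Measurable fun p : Matrix (Fin d) (Fin d) ℝ × Param d => (CFC.sqrt p.1, p.2) :=
    (Matrix.measurable_sqrt.comp measurable_fst).prodMk measurable_snd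
  have hf := hc.measurable.comp hq
  refine Measure.measurable_of_measurable_coe _ fun A hA => ?_
  convert measurable_measure_prodMk_left (ν := stdGaussian (Param d)) (hf hA) using 2 with S
  rw [multivariateGaussian, Measure.map_apply (by fun_prop) hA]
  congr 1
  ext x
  simp only [Set.mem_preimage, zero_add]
  rfl

/-- The centered Gaussian law as a kernel in its covariance matrix. -/
noncomputable def gaussianKernel (d : ℕ) : Kernel (Matrix (Fin d) (Fin d) ℝ) (Param d) where
  toFun S := multivariateGaussian 0 S
  measurable' := measurable_multivariateGaussian

@[simp]
lemma gaussianKernel_apply (S : Matrix (Fin d) (Fin d) ℝ) :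
    gaussianKernel d S = multivariateGaussian 0 S := rfl

instance : IsMarkovKernel (gaussianKernel d) := ⟨fun S => by rw [gaussianKernel_apply]; infer_instance⟩

lemma multivariateGaussian_conv {A B : Matrix (Fin d) (Fin d) ℝ}
    (hA : A.PosSemidef) (hB : B.PosSemidef) :
    (multivariateGaussian (0 : Param d) A) ∗ (multivariateGaussian 0 B) =
      multivariateGaussian 0 (A + B) := by
  refine Measure.ext_of_charFun ?_
  ext t
  rw [charFun_conv, charFun_multivariateGaussian hA, charFun_multivariateGaussian hB,
    charFun_multivariateGaussian (hA.add hB), ← Complex.exp_add]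
  congr 1
  simp only [inner_zero_right, Matrix.add_mulVec, dotProduct_add]
  push_cast
  ring

lemma multivariateGaussian_zero_cov :
    multivariateGaussian (0 : Param d) (0 : Matrix (Fin d) (Fin d) ℝ) = Measure.dirac 0 := by
  rw [multivariateGaussian, CFC.sqrt_zero]
  simp

/-- Complex coefficients allow an exponential tilt and a characteristic function to be evaluated in
a single integral. -/
lemma integral_exp_sum_stdGaussian (z : Fin d → ℂ) :
    ∫ x, Complex.exp (∑ i, z i * (x i : ℂ)) ∂(stdGaussian (Param d)) =
      ∏ i, Complex.exp (z i ^ 2 / 2) := by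
  rw [← map_pi_eq_stdGaussian, integral_map (by fun_prop)
    (Measurable.aestronglyMeasurable (by fun_prop))]
  simp only [Complex.exp_sum]
  rw [integral_fintype_prod_eq_prod (f := fun i (x : ℝ) => Complex.exp (z i * (x : ℂ)))]
  refine Finset.prod_congr rfl fun i _ => ?_
  have := complexMGF_gaussianReal (p := gaussianReal 0 1) (X := id) (Measure.map_id) (z i)
  simp only [complexMGF, id] at this
  rw [this]
  simp

lemma integrable_exp_inner_stdGaussian (v : Param d) :
    Integrable (fun x => Real.exp ⟪x, v⟫) (stdGaussian (Param d)) := by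
  rw [← map_pi_eq_stdGaussian, integrable_map_measure
    (Measurable.aestronglyMeasurable (by fun_prop)) (by fun_prop)]
  have : (fun x : Param d => Real.exp ⟪x, v⟫) ∘ WithLp.toLp 2 =
      fun x : Fin d → ℝ => ∏ i, Real.exp (v i * x i) := by
    ext x
    simp [PiLp.inner_apply, Real.exp_sum, mul_comm]
  rw [this]
  exact Integrable.fintype_prod fun i => integrable_exp_mul_gaussianReal (v i)

/-- Cameron–Martin for the standard Gaussian. Both sides are finite measures, and their
characteristic functions agree: the tilt corresponds to coefficients `v + i t`, the shift to `i t`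
with a phase. -/
lemma stdGaussian_withDensity_exp (v : Param d) :
    (stdGaussian (Param d)).withDensity
        (fun x => ENNReal.ofReal (Real.exp (⟪x, v⟫ - ‖v‖ ^ 2 / 2))) =
      (stdGaussian (Param d)).map (fun x => x + v) := by
  have hint : Integrable (fun x : Param d => Real.exp (⟪x, v⟫ - ‖v‖ ^ 2 / 2))
      (stdGaussian (Param d)) := by
    simp only [sub_eq_add_neg, Real.exp_add]
    exact (integrable_exp_inner_stdGaussian v).mul_const _
  have : IsFiniteMeasure ((stdGaussian (Param d)).withDensity
        (fun x => ENNReal.ofReal (Real.exp (⟪x, v⟫ - ‖v‖ ^ 2 / 2)))) :=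
    isFiniteMeasure_withDensity_ofReal hint.2
  have : IsProbabilityMeasure ((stdGaussian (Param d)).map (fun x => x + v)) :=
    Measure.isProbabilityMeasure_map (by fun_prop)
  refine Measure.ext_of_charFun ?_
  ext t
  rw [charFun_apply, charFun_apply, integral_map (by fun_prop)
    (Measurable.aestronglyMeasurable (by fun_prop)),
    integral_withDensity_eq_integral_toReal_smul (by fun_prop) (by simp)]
  have h1 : ∀ x : Param d, (ENNReal.ofReal (Real.exp (⟪x, v⟫ - ‖v‖ ^ 2 / 2))).toReal •
      Complex.exp (⟪x, t⟫ * Complex.I) =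
      Complex.exp (∑ i, ((v i : ℂ) + t i * Complex.I) * (x i : ℂ)) *
        Complex.exp (-(‖v‖ ^ 2 / 2 : ℝ)) := by
    intro x
    rw [ENNReal.toReal_ofReal (Real.exp_nonneg _), Complex.real_smul, Complex.ofReal_exp,
      ← Complex.exp_add, ← Complex.exp_add]
    congr 1
    simp only [PiLp.inner_apply, add_mul, Finset.sum_add_distrib]
    push_cast
    rw [Finset.sum_mul]
    have e1 : ∀ i, (t i : ℂ) * Complex.I * (x i : ℂ) = (t i : ℂ) * (x i : ℂ) * Complex.I :=
      fun i => by ring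
    simp [e1]
    ring
  have h2 : ∀ x : Param d, Complex.exp (⟪x + v, t⟫ * Complex.I) =
      Complex.exp (∑ i, (t i * Complex.I) * (x i : ℂ)) * Complex.exp (⟪v, t⟫ * Complex.I) := by
    intro x
    rw [← Complex.exp_add]
    congr 1
    rw [inner_add_left]
    simp only [PiLp.inner_apply]
    push_cast
    rw [add_mul, Finset.sum_mul]
    congr 1
    refine Finset.sum_congr rfl fun i _ => ?_
    simp
    ring
  simp_rw [h1, h2]
  rw [integral_mul_const, integral_mul_const, integral_exp_sum_stdGaussian,
    integral_exp_sum_stdGaussian, ← Complex.exp_sum, ← Complex.exp_sum, ← Complex.exp_add,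
    ← Complex.exp_add]
  congr 1
  rw [EuclideanSpace.real_norm_sq_eq]
  simp only [PiLp.inner_apply]
  push_cast
  rw [Finset.sum_mul, Finset.sum_div, ← Finset.sum_neg_distrib, ← Finset.sum_add_distrib,
    ← Finset.sum_add_distrib]
  refine Finset.sum_congr rfl fun i _ => ?_
  have := Complex.I_sq
  simp
  ring

/-- Pull back along `A = √S`: tilting in direction `v` becomes a standard tilt in direction `A v`,
and the resulting shift by `A v` is carried to `A (A v) = S v`. No invertibility of `S` is needed.
-/
lemma lintegral_exp_mul_multivariateGaussian {S : Matrix (Fin d) (Fin d) ℝ} (hS : S.PosSemidef)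
    (v : Param d) {f : Param d → ℝ≥0∞} (hf : Measurable f) :
    ∫⁻ x, ENNReal.ofReal (Real.exp (⟪x, v⟫ - ⟪v, toEuclideanCLM (𝕜 := ℝ) S v⟫ / 2)) * f x
        ∂(multivariateGaussian 0 S) =
      ∫⁻ x, f (x + toEuclideanCLM (𝕜 := ℝ) S v) ∂(multivariateGaussian 0 S) := by
  set A := toEuclideanCLM (𝕜 := ℝ) (CFC.sqrt S) with hA
  have hAA : toEuclideanCLM (𝕜 := ℝ) S = A * A := by
    rw [hA, ← map_mul, CFC.sqrt_mul_sqrt_self _ hS.nonneg]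
  have hsa : IsSelfAdjoint A := (CFC.sqrt_nonneg S).isSelfAdjoint.map _
  have hin : ∀ x y, ⟪A x, y⟫ = ⟪x, A y⟫ := fun x y => by
    conv_lhs => rw [← hsa.adjoint_eq, ContinuousLinearMap.adjoint_inner_left]
  rw [multivariateGaussian, lintegral_map (by fun_prop) (by fun_prop),
    lintegral_map (by fun_prop) (by fun_prop)]
  have hAv : (A * A) v = A (A v) := rfl
  simp only [zero_add, hAA, hAv, ← hA, ← map_add]
  have h := stdGaussian_withDensity_exp (A v)
  have h3 := congrArg (fun m : Measure (Param d) => ∫⁻ y, f (A y) ∂m) h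
  simp only at h3
  rw [lintegral_map (by fun_prop) (by fun_prop),
    lintegral_withDensity_eq_lintegral_mul _ (by fun_prop) (by fun_prop)] at h3
  rw [← h3]
  refine lintegral_congr fun y => ?_
  simp only [Pi.mul_apply, ← real_inner_self_eq_norm_sq, hin]

lemma integral_inner_multivariateGaussian (S : Matrix (Fin d) (Fin d) ℝ) (v : Param d) :
    ∫ x, ⟪x, v⟫ ∂(multivariateGaussian 0 S) = 0 := by
  simp_rw [real_inner_comm v]
  have h := integral_inner (𝕜 := ℝ) (f := fun x : Param d => x) (μ := multivariateGaussian 0 S)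
    IsGaussian.integrable_id v
  rw [h]
  simp

lemma integral_inner_sq_multivariateGaussian {S : Matrix (Fin d) (Fin d) ℝ} (hS : S.PosSemidef)
    (v : Param d) :
    ∫ x, ⟪x, v⟫ ^ 2 ∂(multivariateGaussian 0 S) = ⟪v, toEuclideanCLM (𝕜 := ℝ) S v⟫ := by
  have h := covarianceBilin_multivariateGaussian (μ := (0 : Param d)) hS v v
  rw [covarianceBilin_apply IsGaussian.memLp_two_id] at h
  simp only [id_eq, integral_id_multivariateGaussian, sub_zero] at h
  rw [inner_toEuclideanCLM, ← h]
  simp only [sq, real_inner_comm]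

lemma integrable_inner_sq_multivariateGaussian (S : Matrix (Fin d) (Fin d) ℝ) (v : Param d) :
    Integrable (fun x => ⟪x, v⟫ ^ 2) (multivariateGaussian 0 S) := by
  have h : MemLp (fun x : Param d => ⟪v, x⟫) 2 (multivariateGaussian 0 S) :=
    (IsGaussian.memLp_two_id).const_inner v
  simp_rw [real_inner_comm v]
  exact h.integrable_sq

end Gaussian

/-! ### Conditional laws given a sub-sigma-field. -/

section CondLaw

open scoped ENNReal

/-- The type `Ω`, equipped with the sigma-field `m`. -/
@[nolint unusedArguments]
def Coarse {Ω : Type*} (_m : MeasurableSpace Ω) : Type _ := Ω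

instance Coarse.instMeasurableSpace {Ω : Type*} (m : MeasurableSpace Ω) :
    MeasurableSpace (Coarse m) := m

/-- The identity map from `Ω` to `Ω` with the sigma-field `m`. -/
def toCoarse {Ω : Type*} (m : MeasurableSpace Ω) (ω : Ω) : Coarse m := ω

lemma measurable_toCoarse {Ω : Type*} {m mΩ : MeasurableSpace Ω} (hm : m ≤ mΩ) :
    Measurable (toCoarse m) := fun _ hs => hm _ hs

/-- Sets of the form `a ∩ b`, with `a` and `b` in two given sigma-fields. -/
def interSets {Ω : Type*} (m₁ m₂ : MeasurableSpace Ω) : Set (Set Ω) :=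
  {s | ∃ a b, MeasurableSet[m₁] a ∧ MeasurableSet[m₂] b ∧ s = a ∩ b}

lemma isPiSystem_interSets {Ω : Type*} (m₁ m₂ : MeasurableSpace Ω) :
    IsPiSystem (interSets m₁ m₂) := by
  rintro _ ⟨a, b, ha, hb, rfl⟩ _ ⟨a', b', ha', hb', rfl⟩ -
  exact ⟨a ∩ a', b ∩ b', MeasurableSet.inter ha ha', MeasurableSet.inter hb hb',
    Set.inter_inter_inter_comm _ _ _ _⟩

lemma sup_eq_generateFrom_interSets {Ω : Type*} (m₁ m₂ : MeasurableSpace Ω) :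
    m₁ ⊔ m₂ = MeasurableSpace.generateFrom (interSets m₁ m₂) := by
  refine le_antisymm (sup_le ?_ ?_) (MeasurableSpace.generateFrom_le ?_)
  · exact fun a ha => MeasurableSpace.measurableSet_generateFrom
      ⟨a, Set.univ, ha, MeasurableSet.univ, (Set.inter_univ a).symm⟩
  · exact fun b hb => MeasurableSpace.measurableSet_generateFrom
      ⟨Set.univ, b, MeasurableSet.univ, hb, (Set.univ_inter b).symm⟩
  · rintro _ ⟨a, b, ha, hb, rfl⟩
    exact MeasurableSet.inter ((le_sup_left : m₁ ≤ m₁ ⊔ m₂) _ ha)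
      ((le_sup_right : m₂ ≤ m₁ ⊔ m₂) _ hb)

variable {Ω E : Type*} {m m' m₂ mΩ : MeasurableSpace Ω} [MeasurableSpace E] {μ : Measure Ω}
  [IsProbabilityMeasure μ] {X : Ω → E} {κ : Kernel (Coarse m) E} [IsMarkovKernel κ]

/-- Conditioning on a sigma-field is conditioning on the identity map into the coarser space; the
joint law is determined by its values on rectangles. -/
lemma hasCondDistrib_toCoarse_iff (hm : m ≤ mΩ) (hX : Measurable X) :
    HasCondDistrib X (toCoarse m) κ μ ↔ ∀ s, MeasurableSet[m] s → ∀ t, MeasurableSet t →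
      μ (s ∩ X ⁻¹' t) = ∫⁻ ω in s, κ (toCoarse m ω) t ∂μ := by
  have hc := measurable_toCoarse hm
  have : IsProbabilityMeasure (μ.map (toCoarse m)) :=
    Measure.isProbabilityMeasure_map hc.aemeasurable
  have h1 : ∀ (s : Set (Coarse m)) (t : Set E), MeasurableSet s → MeasurableSet t →
      μ.map (fun ω => (toCoarse m ω, X ω)) (s ×ˢ t) = μ (toCoarse m ⁻¹' s ∩ X ⁻¹' t) :=
    fun s t hs ht => by
      rw [Measure.map_apply (hc.prodMk hX) (hs.prod ht)]
      rfl
  have h2 : ∀ (s : Set (Coarse m)) (t : Set E), MeasurableSet s → MeasurableSet t →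
      ((μ.map (toCoarse m)) ⊗ₘ κ) (s ×ˢ t) =
        ∫⁻ ω in toCoarse m ⁻¹' s, κ (toCoarse m ω) t ∂μ := fun s t hs ht => by
    rw [Measure.compProd_apply_prod hs ht,
      setLIntegral_map hs (Kernel.measurable_coe κ ht) hc]
  constructor
  · intro h s hs t ht
    have := h2 s t hs ht
    rw [← h.map_eq, h1 s t hs ht] at this
    exact this
  · intro h
    have : IsProbabilityMeasure (μ.map (fun ω => (toCoarse m ω, X ω))) :=
      Measure.isProbabilityMeasure_map (hc.prodMk hX).aemeasurable
    refine ⟨(hc.prodMk hX).aemeasurable, Measure.ext_prod fun {s t} hs ht => ?_⟩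
    rw [h1 s t hs ht, h2 s t hs ht]
    exact h s hs t ht

/-- Passes from the set-by-set conditional expectations of the hypotheses to a kernel, for which
disintegration of integrals is available. -/
lemma HasCondLaw.hasCondDistrib {ν : Ω → Measure E} (h : HasCondLaw μ m X ν) (hm : m ≤ mΩ)
    (hX : Measurable X) (hν : ∀ᵐ ω ∂μ, ν ω = κ (toCoarse m ω)) :
    HasCondDistrib X (toCoarse m) κ μ := by
  refine (hasCondDistrib_toCoarse_iff hm hX).2 fun s hs t ht => ?_
  have hmt : MeasurableSet (X ⁻¹' t) := hX ht
  have hint : Integrable ((X ⁻¹' t).indicator (fun _ => (1 : ℝ))) μ :=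
    (integrable_const 1).indicator hmt
  have h1 := setIntegral_condExp hm hint hs
  rw [integral_indicator_const _ hmt, measureReal_restrict_apply hmt] at h1
  have h2 : ∫ ω in s, (κ (toCoarse m ω)).real t ∂μ = μ.real (X ⁻¹' t ∩ s) := by
    rw [smul_eq_mul, mul_one] at h1
    rw [← h1]
    refine integral_congr_ae (ae_restrict_of_ae ?_)
    filter_upwards [h t ht, hν] with ω h3 h4
    rw [h3, h4]
  have hk : Measurable fun ω => κ (toCoarse m ω) t :=
    (Kernel.measurable_coe κ ht).comp (measurable_toCoarse hm)
  rw [Set.inter_comm, ← ENNReal.ofReal_toReal (measure_ne_top μ (X ⁻¹' t ∩ s))]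
  change ENNReal.ofReal (μ.real _) = _
  rw [← h2, ofReal_integral_eq_lintegral_ofReal]
  · exact lintegral_congr fun ω => by simp
  · refine Integrable.of_bound (C := 1) hk.ennreal_toReal.aestronglyMeasurable ?_
    filter_upwards with ω
    rw [Real.norm_of_nonneg measureReal_nonneg]
    exact measureReal_le_one
  · filter_upwards with ω using measureReal_nonneg

/-- A conditional law is not changed by adjoining independent information. -/
lemma ProbabilityTheory.HasCondDistrib.sup_of_indep
    (h : HasCondDistrib X (toCoarse m) κ μ) (hm : m ≤ mΩ) (hm' : m' ≤ mΩ) (hX : Measurable X)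
    (hind : Indep (m ⊔ MeasurableSpace.comap X inferInstance) m' μ)
    {κ' : Kernel (Coarse (m ⊔ m')) E} [IsMarkovKernel κ']
    (hκ : ∀ ω, κ' (toCoarse _ ω) = κ (toCoarse m ω)) :
    HasCondDistrib X (toCoarse (m ⊔ m')) κ' μ := by
  have hle : m ⊔ m' ≤ mΩ := sup_le hm hm'
  rw [hasCondDistrib_toCoarse_iff hm hX] at h
  refine (hasCondDistrib_toCoarse_iff hle hX).2 fun s hs t ht => ?_
  have hk : Measurable fun ω => κ (toCoarse m ω) t :=
    (Kernel.measurable_coe κ ht).comp (measurable_toCoarse hm)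
  have hkm : Measurable[m] fun ω => κ (toCoarse m ω) t := Kernel.measurable_coe κ ht
  -- For fixed `t`, both sides are measures on `m ⊔ m'`. On a set `a ∩ b` of the generating
  -- π-system, independence extracts the factor `μ b` from each, leaving the known identity on `a`.
  have key : (μ.restrict (X ⁻¹' t)).trim hle =
      (μ.withDensity fun ω => κ (toCoarse m ω) t).trim hle := by
    have hset : ∀ s, MeasurableSet[m ⊔ m'] s → s ∈ interSets m m' →
        (μ.restrict (X ⁻¹' t)).trim hle s =
          (μ.withDensity fun ω => κ (toCoarse m ω) t).trim hle s := by
      rintro _ hs ⟨a, b, ha, hb, rfl⟩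
      rw [trim_measurableSet_eq hle hs, trim_measurableSet_eq hle hs,
        Measure.restrict_apply (hle _ hs), withDensity_apply _ (hle _ hs)]
      have e1 : a ∩ b ∩ X ⁻¹' t = (a ∩ X ⁻¹' t) ∩ b := by
        ext; simp only [Set.mem_inter_iff]; tauto
      have hax : MeasurableSet[m ⊔ MeasurableSpace.comap X inferInstance] (a ∩ X ⁻¹' t) :=
        MeasurableSet.inter ((le_sup_left : m ≤ _) _ ha)
          ((le_sup_right : MeasurableSpace.comap X inferInstance ≤
            m ⊔ MeasurableSpace.comap X inferInstance) _ ⟨t, ht, rfl⟩)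
      rw [e1, (Indep_iff _ _ μ).1 hind _ _ hax hb, h a ha t ht]
      have e2 : ∫⁻ ω in a ∩ b, κ (toCoarse m ω) t ∂μ =
          ∫⁻ ω, a.indicator (fun ω => κ (toCoarse m ω) t) ω * b.indicator (fun _ => 1) ω ∂μ := by
        rw [← lintegral_indicator ((hm _ ha).inter (hm' _ hb))]
        refine lintegral_congr fun ω => ?_
        by_cases h1 : ω ∈ a <;> by_cases h2 : ω ∈ b <;> simp [h1, h2]
      rw [e2, lintegral_mul_eq_lintegral_mul_lintegral_of_independent_measurableSpace hm hm'
        (indep_of_indep_of_le_left hind le_sup_left) (hkm.indicator ha)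
        (measurable_const.indicator hb), lintegral_indicator (hm _ ha),
        lintegral_indicator (hm' _ hb), setLIntegral_one]
    have hfin : IsFiniteMeasure ((μ.restrict (X ⁻¹' t)).trim hle) := inferInstance
    refine @ext_of_generate_finite Ω (m ⊔ m') _ _ (interSets m m')
      (sup_eq_generateFrom_interSets m m') (isPiSystem_interSets m m') hfin (fun s hs => ?_) ?_
    · refine hset s ?_ hs
      rw [sup_eq_generateFrom_interSets]
      exact MeasurableSpace.measurableSet_generateFrom hs
    · exact hset _ MeasurableSet.univ
        ⟨Set.univ, Set.univ, MeasurableSet.univ, MeasurableSet.univ, (Set.inter_univ _).symm⟩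
  have := congrFun (congrArg (fun ν : @Measure Ω (m ⊔ m') => (ν : Set Ω → ℝ≥0∞)) key) s
  rw [trim_measurableSet_eq hle hs, trim_measurableSet_eq hle hs,
    Measure.restrict_apply (hle _ hs), withDensity_apply _ (hle _ hs)] at this
  simp only [hκ]
  exact this

lemma ProbabilityTheory.HasCondDistrib.lintegral_toCoarse
    (h : HasCondDistrib X (toCoarse m) κ μ) (hm : m ≤ mΩ) {F : Coarse m × E → ℝ≥0∞}
    (hF : Measurable F) :
    ∫⁻ ω, F (toCoarse m ω, X ω) ∂μ = ∫⁻ ω, ∫⁻ x, F (toCoarse m ω, x) ∂κ (toCoarse m ω) ∂μ := by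
  have hc := measurable_toCoarse hm
  have : IsProbabilityMeasure (μ.map (toCoarse m)) :=
    Measure.isProbabilityMeasure_map hc.aemeasurable
  rw [← lintegral_map' hF.aemeasurable h.aemeasurable, h.map_eq, Measure.lintegral_compProd hF,
    lintegral_map hF.lintegral_kernel_prod_right' hc]

lemma ProbabilityTheory.HasCondDistrib.integral_toCoarse
    (h : HasCondDistrib X (toCoarse m) κ μ) (hm : m ≤ mΩ) {F : Coarse m × E → ℝ}
    (hF : Measurable F) (hint : Integrable (fun ω => F (toCoarse m ω, X ω)) μ) :
    (∀ᵐ ω ∂μ, Integrable (fun x => F (toCoarse m ω, x)) (κ (toCoarse m ω))) ∧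
    Integrable (fun ω => ∫ x, F (toCoarse m ω, x) ∂κ (toCoarse m ω)) μ ∧
    ∫ ω, F (toCoarse m ω, X ω) ∂μ = ∫ ω, ∫ x, F (toCoarse m ω, x) ∂κ (toCoarse m ω) ∂μ := by
  have hc := measurable_toCoarse hm
  have : IsProbabilityMeasure (μ.map (toCoarse m)) :=
    Measure.isProbabilityMeasure_map hc.aemeasurable
  have h1 : Integrable F ((μ.map (toCoarse m)) ⊗ₘ κ) := by
    rw [← h.map_eq, integrable_map_measure hF.aestronglyMeasurable h.aemeasurable]
    exact hint
  have h2 : Integrable (fun a => ∫ x, F (a, x) ∂κ a) (μ.map (toCoarse m)) := h1.integral_compProd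
  refine ⟨ae_of_ae_map hc.aemeasurable
    ((Measure.integrable_compProd_iff hF.aestronglyMeasurable).1 h1).1,
    (integrable_map_measure h2.1 hc.aemeasurable).1 h2, ?_⟩
  rw [← integral_map (f := F) h.aemeasurable hF.aestronglyMeasurable, h.map_eq,
    Measure.integral_compProd h1, integral_map hc.aemeasurable h2.1]

/-- The Gaussian kernel `ω ↦ N(0, S ω)` for an `m`-measurable random matrix `S`. -/
noncomputable def condGaussian {d : ℕ} (S : Ω → Matrix (Fin d) (Fin d) ℝ) (hS : Measurable[m] S) :
    Kernel (Coarse m) (Param d) :=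
  Kernel.comap (gaussianKernel d) (fun ω : Coarse m => S ω) hS

instance {d : ℕ} (S : Ω → Matrix (Fin d) (Fin d) ℝ) (hS : Measurable[m] S) :
    IsMarkovKernel (condGaussian S hS) :=
  Kernel.IsMarkovKernel.comap (gaussianKernel d) hS

/-- Sums of conditionally Gaussian vectors are conditionally Gaussian. -/
lemma hasCondDistrib_add_gaussian {d : ℕ} {X Y : Ω → Param d}
    {A B : Ω → Matrix (Fin d) (Fin d) ℝ} (hm : m ≤ m₂) (hm₂ : m₂ ≤ mΩ)
    (hX : Measurable[m₂] X) (hY : Measurable Y) (hA : Measurable[m] A) (hB : Measurable[m] B)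
    (hAp : ∀ᵐ ω ∂μ, (A ω).PosSemidef) (hBp : ∀ᵐ ω ∂μ, (B ω).PosSemidef)
    (h₁ : HasCondDistrib X (toCoarse m)
      (condGaussian A hA) μ)
    (h₂ : HasCondDistrib Y (toCoarse m₂)
      (condGaussian B (hB.mono hm le_rfl)) μ)
    (hAB : Measurable[m] fun ω => A ω + B ω) :
    HasCondDistrib (fun ω => X ω + Y ω) (toCoarse m)
      (condGaussian (fun ω => A ω + B ω) hAB) μ := by
  have hmm := hm.trans hm₂
  have hX' : Measurable X := hX.mono hm₂ le_rfl
  refine (hasCondDistrib_toCoarse_iff (X := fun ω => X ω + Y ω) hmm (hX'.add hY)).2 fun s hs t ht => ?_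
  have hst : MeasurableSet (s ∩ (fun ω => X ω + Y ω) ⁻¹' t) :=
    (hmm _ hs).inter ((hX'.add hY) ht)
  -- Tower argument: integrate `Y` out given `m₂`, where `X` is frozen. As `B` is already
  -- `m`-measurable, the result `F₁` is a function of `m`-data and `X`, and `X` can then be
  -- integrated out given `m`.
  let F₂ : Coarse m₂ × Param d → ℝ≥0∞ := fun p =>
    Set.indicator (α := Coarse m₂) s 1 p.1 *
      t.indicator 1 ((fun ω : Coarse m₂ => X ω) p.1 + p.2)
  have hF₂ : Measurable F₂ := by
    have hX₂ : Measurable (fun ω : Coarse m₂ => X ω) := hX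
    have hs₂ : MeasurableSet (α := Coarse m₂) s := hm _ hs
    exact ((measurable_one.indicator hs₂).comp measurable_fst).mul
      ((measurable_one.indicator ht).comp ((hX₂.comp measurable_fst).add measurable_snd))
  let κB : Kernel (Coarse m) (Param d) := condGaussian B hB
  let F₁ : Coarse m × Param d → ℝ≥0∞ := fun p =>
    Set.indicator (α := Coarse m) s 1 p.1 * ∫⁻ y, t.indicator 1 (p.2 + y) ∂(κB p.1)
  have hF₁ : Measurable F₁ := by
    have hs₁ : MeasurableSet (α := Coarse m) s := hs
    refine ((measurable_one.indicator hs₁).comp measurable_fst).mul ?_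
    exact Measurable.lintegral_kernel_prod_right (κ := κB.comap Prod.fst measurable_fst)
      (f := fun (p : Coarse m × Param d) (y : Param d) => t.indicator (1 : Param d → ℝ≥0∞) (p.2 + y))
      ((measurable_one.indicator ht).comp
        ((measurable_snd.comp measurable_fst).add measurable_snd))
  have e2 := h₂.lintegral_toCoarse hm₂ hF₂
  have e1 := h₁.lintegral_toCoarse hmm hF₁
  have l2 : ∫⁻ ω, F₂ (toCoarse m₂ ω, Y ω) ∂μ = μ (s ∩ (fun ω => X ω + Y ω) ⁻¹' t) := by
    rw [← lintegral_indicator_one hst]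
    refine lintegral_congr fun ω => ?_
    change s.indicator 1 ω * t.indicator 1 (X ω + Y ω) = _
    by_cases h1 : ω ∈ s <;> by_cases h2 : X ω + Y ω ∈ t <;> simp [h1, h2]
    rfl
  have l3 : ∫⁻ ω, ∫⁻ x, F₂ (toCoarse m₂ ω, x) ∂(condGaussian B
      (hB.mono hm le_rfl : Measurable[m₂] B)) (toCoarse m₂ ω) ∂μ =
      ∫⁻ ω, F₁ (toCoarse m ω, X ω) ∂μ := by
    refine lintegral_congr fun ω => ?_
    change ∫⁻ x, s.indicator 1 ω * t.indicator 1 (X ω + x) ∂(multivariateGaussian 0 (B ω)) =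
      s.indicator 1 ω * ∫⁻ y, t.indicator 1 (X ω + y) ∂(multivariateGaussian 0 (B ω))
    exact lintegral_const_mul _ ((measurable_one.indicator ht).comp (measurable_const_add _))
  rw [← l2, e2, l3, e1, ← lintegral_indicator (hmm _ hs)]
  refine lintegral_congr_ae ?_
  filter_upwards [hAp, hBp] with ω ha hb
  change ∫⁻ x, s.indicator 1 ω * ∫⁻ y, t.indicator 1 (x + y) ∂(multivariateGaussian 0 (B ω))
    ∂(multivariateGaussian 0 (A ω)) =
    s.indicator (fun ω => multivariateGaussian 0 (A ω + B ω) t) ω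
  have hmt : Measurable (t.indicator (1 : Param d → ℝ≥0∞)) := measurable_one.indicator ht
  rw [lintegral_const_mul _ (Measurable.lintegral_prod_right'
      (f := fun p : Param d × Param d => t.indicator (1 : Param d → ℝ≥0∞) (p.1 + p.2))
      (hmt.comp (measurable_fst.add measurable_snd))),
    ← Measure.lintegral_conv hmt, multivariateGaussian_conv ha hb, lintegral_indicator_one ht]
  by_cases h1 : ω ∈ s <;> simp [h1]

end CondLaw

/-! ### Measurability of gradients, risks and quadratic forms. -/

section LossMeasurability

variable {𝒵 : Type*} [MeasurableSpace 𝒵] {d n : ℕ} {loss : Param d → 𝒵 → ℝ}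

/-- Each coordinate of the gradient is a pointwise limit of difference quotients with step `1 / (k +
1)`, which are jointly measurable; no continuity of the gradient is required. -/
lemma measurable_sampleGrad (hm : Measurable (Function.uncurry loss))
    (hd : ∀ z, Differentiable ℝ fun w => loss w z) :
    Measurable fun p : Param d × 𝒵 => sampleGrad loss p.1 p.2 := by
  have hcoord : ∀ i : Fin d, Measurable fun p : Param d × 𝒵 => sampleGrad loss p.1 p.2 i := by
    intro i
    let e : Param d := EuclideanSpace.single i 1
    let u : ℕ → Param d × 𝒵 → ℝ := fun k p =>
      ((k : ℝ) + 1) * (loss (p.1 + ((k : ℝ) + 1)⁻¹ • e) p.2 - loss p.1 p.2)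
    have hu : ∀ k, Measurable (u k) := fun k => by
      refine measurable_const.mul (Measurable.sub ?_ hm)
      exact hm.comp ((measurable_fst.add_const _).prodMk measurable_snd)
    refine measurable_of_tendsto_metrizable hu (tendsto_pi_nhds.2 fun p => ?_)
    have hg := ((hd p.2) p.1).hasGradientAt.hasFDerivAt
    have hval : sampleGrad loss p.1 p.2 i =
        (InnerProductSpace.toDual ℝ (Param d) (gradient (fun v => loss v p.2) p.1)) e := by
      rw [InnerProductSpace.toDual_apply_apply]
      rw [EuclideanSpace.inner_single_right]
      simp [sampleGrad]
    rw [hval]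
    have hc : Filter.Tendsto (fun k : ℕ => (k : ℝ) + 1) Filter.atTop Filter.atTop :=
      Filter.tendsto_atTop_add_const_right _ _ tendsto_natCast_atTop_atTop
    have := hg.lim e (c := fun k : ℕ => (k : ℝ) + 1) (l := Filter.atTop)
      (by simpa [Function.comp_def] using (Filter.tendsto_abs_atTop_atTop.comp hc))
    simpa [u, smul_eq_mul] using this
  have : (fun p : Param d × 𝒵 => sampleGrad loss p.1 p.2) =
      fun p => WithLp.toLp 2 fun i => sampleGrad loss p.1 p.2 i := rfl
  rw [this]
  exact (WithLp.measurable_toLp 2 _).comp (measurable_pi_lambda _ hcoord)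

lemma measurable_popGrad (hm : Measurable (Function.uncurry loss))
    (hd : ∀ z, Differentiable ℝ fun w => loss w z) (D : Measure 𝒵) [SFinite D] :
    Measurable (popGrad loss D) :=
  ((measurable_sampleGrad hm hd).stronglyMeasurable.integral_prod_right).measurable

lemma measurable_empRisk (hm : Measurable (Function.uncurry loss)) :
    Measurable fun p : Param d × (Fin n → 𝒵) => empRisk loss p.1 p.2 := by
  refine measurable_const.mul (Finset.measurable_sum _ fun i _ => ?_)
  exact hm.comp (measurable_fst.prodMk ((measurable_pi_apply i).comp measurable_snd))

lemma measurable_minibatchGrad (hm : Measurable (Function.uncurry loss))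
    (hd : ∀ z, Differentiable ℝ fun w => loss w z) :
    Measurable fun p : Finset (Fin n) × (Param d × (Fin n → 𝒵)) =>
      minibatchGrad loss p.2.1 p.1 p.2.2 := by
  refine measurable_from_prod_countable_right fun J => ?_
  have h : Measurable fun p : Param d × (Fin n → 𝒵) => ∑ i ∈ J, sampleGrad loss p.1 (p.2 i) :=
    Finset.measurable_sum _ fun i _ => (measurable_sampleGrad hm hd).comp
      (measurable_fst.prodMk ((measurable_pi_apply i).comp measurable_snd))
  exact h.const_smul ((J.card : ℝ)⁻¹)

lemma matrixMeasurable_iff {Ω : Type*} {m : MeasurableSpace Ω}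
    {M : Ω → Matrix (Fin d) (Fin d) ℝ} : MatrixMeasurable m M ↔ Measurable[m] M := by
  constructor
  · intro h
    exact measurable_pi_lambda _ fun i => measurable_pi_lambda _ fun j => h i j
  · intro h i j
    exact (measurable_pi_apply j).comp ((measurable_pi_apply i).comp h)

lemma measurable_sqNormIn :
    Measurable fun p : Matrix (Fin d) (Fin d) ℝ × Param d => sqNormIn p.1 p.2 := by
  have : Continuous fun p : Matrix (Fin d) (Fin d) ℝ × Param d => sqNormIn p.1 p.2 := by
    have h := (PiLp.continuous_ofLp 2 (fun _ : Fin d => ℝ)).comp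
      (continuous_snd (X := Matrix (Fin d) (Fin d) ℝ))
    exact h.dotProduct (continuous_fst.matrix_mulVec h)
  exact this.measurable

/-- The adjugate formula holds everywhere under the convention that singular matrices have inverse
0. -/
lemma Matrix.measurable_inv :
    Measurable fun M : Matrix (Fin d) (Fin d) ℝ => M⁻¹ := by
  have : (fun M : Matrix (Fin d) (Fin d) ℝ => M⁻¹) = fun M => (M.det)⁻¹ • M.adjugate := by
    ext1 M
    rw [Matrix.inv_def, Ring.inverse_eq_inv']
  rw [this]
  have h1 : Measurable fun M : Matrix (Fin d) (Fin d) ℝ => M.det :=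
    (continuous_id.matrix_det).measurable
  have h2 : Measurable fun M : Matrix (Fin d) (Fin d) ℝ => M.adjugate :=
    (continuous_id.matrix_adjugate).measurable
  refine measurable_pi_lambda _ fun i => measurable_pi_lambda _ fun j => ?_
  exact h1.inv.mul ((measurable_pi_apply j).comp ((measurable_pi_apply i).comp h2))

end LossMeasurability

/-! ### Inclusions among the sigma-fields and recursions for the paths. -/

namespace VirtualSGD

section Fields

variable {Ω 𝒵 : Type*} [MeasurableSpace 𝒵] {d n N : ℕ}
  (P : VirtualSGD Ω 𝒵 d n N)

/-- The sigma-field of the real history, both samples, the auxiliary randomness and the first `t`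
virtual perturbations. -/
@[reducible] noncomputable def fullField (t : ℕ) : MeasurableSpace Ω :=
  (P.history N ⊔ P.sampleField ⊔ P.aux ⊔ P.noiseField t) ⊔
    MeasurableSpace.comap P.ghost inferInstance

lemma comap_noise_le {k t : ℕ} (h : k < t) :
    MeasurableSpace.comap (P.noise k) inferInstance ≤ P.noiseField t :=
  le_iSup₂_of_le k (Finset.mem_range.2 h) le_rfl

lemma noiseField_mono : Monotone P.noiseField := fun _ _ h =>
  iSup₂_le fun _ hk => P.comap_noise_le ((Finset.mem_range.1 hk).trans_le h)

lemma fullField_mono : Monotone P.fullField := fun _ _ h =>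
  sup_le_sup_right (sup_le_sup_left (P.noiseField_mono h) _) _

lemma history_le_fullField (t : ℕ) : P.history N ≤ P.fullField t :=
  le_sup_of_le_left (le_sup_of_le_left (le_sup_of_le_left le_sup_left))

lemma sampleField_le_fullField (t : ℕ) : P.sampleField ≤ P.fullField t :=
  le_sup_of_le_left (le_sup_of_le_left (le_sup_of_le_left le_sup_right))

lemma aux_le_fullField (t : ℕ) : P.aux ≤ P.fullField t :=
  le_sup_of_le_left (le_sup_of_le_left le_sup_right)

lemma noiseField_le_fullField (t : ℕ) : P.noiseField t ≤ P.fullField t :=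
  le_sup_of_le_left le_sup_right

lemma ghost_le_fullField (t : ℕ) :
    MeasurableSpace.comap P.ghost inferInstance ≤ P.fullField t := le_sup_right

lemma history_mono : Monotone P.history := fun _ _ h =>
  sup_le_sup (iSup₂_le fun k hk => le_iSup₂_of_le k
      (Finset.mem_range.2 ((Finset.mem_range.1 hk).trans_le (Nat.add_le_add_right h 1))) le_rfl)
    (iSup₂_le fun k hk => le_iSup₂_of_le k
      (Finset.mem_range.2 ((Finset.mem_range.1 hk).trans_le h)) le_rfl)

lemma measurable_iter_history {k r : ℕ} (h : k ≤ r) : Measurable[P.history r] (P.iter k) :=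
  measurable_iff_comap_le.2 (le_sup_of_le_left
    (le_iSup₂_of_le k (Finset.mem_range.2 (Nat.lt_succ_of_le h)) le_rfl))

lemma measurable_stochGrad_history {k r : ℕ} (h : k < r) :
    Measurable[P.history r] (P.stochGrad k) :=
  measurable_iff_comap_le.2 (le_sup_of_le_right
    (le_iSup₂_of_le k (Finset.mem_range.2 h) le_sup_right))

lemma measurable_noise_fullField {k t : ℕ} (h : k < t) :
    Measurable[P.fullField t] (P.noise k) :=
  measurable_iff_comap_le.2 ((P.comap_noise_le h).trans (P.noiseField_le_fullField t))

lemma measurable_stochGrad_fullField {k : ℕ} (t : ℕ) (h : k < N) :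
    Measurable[P.fullField t] (P.stochGrad k) :=
  (P.measurable_stochGrad_history h).mono (P.history_le_fullField t) le_rfl

lemma measurable_iter_fullField {k : ℕ} (t : ℕ) (h : k ≤ N) :
    Measurable[P.fullField t] (P.iter k) :=
  (P.measurable_iter_history h).mono (P.history_le_fullField t) le_rfl

lemma measurable_sample_fullField (t : ℕ) : Measurable[P.fullField t] P.sample :=
  measurable_iff_comap_le.2 (P.sampleField_le_fullField t)

lemma measurable_ghost_fullField (t : ℕ) : Measurable[P.fullField t] P.ghost :=
  measurable_iff_comap_le.2 (P.ghost_le_fullField t)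

lemma measurable_virt_fullField {k t : ℕ} (hk : k ≤ t) (ht : t ≤ N) :
    Measurable[P.fullField t] (P.virt k) := by
  induction k with
  | zero => exact P.measurable_iter_fullField t (Nat.zero_le N)
  | succ k ih =>
    refine ((ih (by omega)).sub ((P.measurable_stochGrad_fullField t (by omega)).const_smul
      (P.rate k))).add (P.measurable_noise_fullField (by omega))

lemma measurable_virt_refField {k t : ℕ} (hk : k ≤ t) : Measurable[P.refField t] (P.virt k) :=
  measurable_iff_comap_le.2 (le_sup_of_le_left
    (le_iSup₂_of_le k (Finset.mem_range.2 (Nat.lt_succ_of_le hk)) le_rfl))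

lemma refField_le_fullField {t : ℕ} (ht : t ≤ N) : P.refField t ≤ P.fullField t :=
  sup_le (iSup₂_le fun _ hk => measurable_iff_comap_le.1
    (P.measurable_virt_fullField (Nat.lt_succ_iff.1 (Finset.mem_range.1 hk)) ht))
    (P.aux_le_fullField t)

lemma refField_zero :
    P.refField 0 = MeasurableSpace.comap P.init inferInstance ⊔ P.aux := by
  simp [refField, virt]

lemma refField_succ (t : ℕ) :
    P.refField (t + 1) =
      P.refField t ⊔ MeasurableSpace.comap (P.virt (t + 1)) inferInstance := by
  simp only [refField]
  rw [Finset.range_add_one (n := t + 1), Finset.iSup_insert, sup_assoc, sup_comm]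

lemma accNoise_zero : P.accNoise 0 = fun _ => 0 := by
  ext1 ω; simp [accNoise, virt, iter]

lemma accNoise_succ (t : ℕ) :
    P.accNoise (t + 1) = fun ω => P.accNoise t ω + P.noise t ω := by
  ext1 ω
  simp only [accNoise, virt, iter, stochGrad]
  abel

lemma accCov_succ (t : ℕ) : P.accCov (t + 1) = fun ω => P.accCov t ω + P.cov t ω := by
  ext1 ω; simp [accCov, Finset.sum_range_succ]

lemma iter_add_accNoise (t : ℕ) (ω : Ω) : P.iter t ω + P.accNoise t ω = P.virt t ω := by
  simp [accNoise]

end Fields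

/-! ### Measurability under the standing assumptions and conditional laws of the perturbations. -/

namespace Conditions

variable {Ω 𝒵 : Type*} [mΩ : MeasurableSpace Ω] [MeasurableSpace 𝒵] {d n N : ℕ}
  {P : VirtualSGD Ω 𝒵 d n N} {μ : Measure Ω} {D : Measure 𝒵} {R : ℝ≥0}

lemma measurable_iter_stochGrad (hP : P.Conditions μ D R) {t : ℕ} :
    (t ≤ N → Measurable (P.iter t)) ∧ (t < N → Measurable (P.stochGrad t)) := by
  have hG : ∀ t < N, Measurable (P.iter t) → Measurable (P.stochGrad t) := fun t ht h => by
    have hp : Measurable fun ω => (P.batch t ω, P.iter t ω, P.sample ω) :=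
      (hP.measurable_batch t ht).prodMk (h.prodMk hP.measurable_sample)
    have h2 := (measurable_minibatchGrad hP.measurable_loss hP.differentiable_loss).comp hp
    exact h2
  have hW : t ≤ N → Measurable (P.iter t) := by
    induction t with
    | zero => exact fun _ => hP.measurable_init
    | succ t ih =>
      intro h
      exact (ih (by omega)).sub ((hG t h (ih (by omega))).const_smul (P.rate t))
  exact ⟨hW, fun h => hG t h (hW h.le)⟩

/-- The finitely many possible index sets split the event into pieces on which the minibatch is a
fixed subfamily of the sample. -/
lemma measurable_minibatch (hP : P.Conditions μ D R) {t : ℕ} (ht : t < N) :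
    Measurable (P.minibatch t) := by
  intro A hA
  have : P.minibatch t ⁻¹' A = ⋃ J : Finset (Fin n), P.batch t ⁻¹' {J} ∩
      (fun ω => fun i : J => P.sample ω i) ⁻¹' 
        {x : J → 𝒵 | (⟨J, x⟩ : Σ J : Finset (Fin n), (J → 𝒵)) ∈ A} := by
    ext ω
    simp only [Set.mem_preimage, Set.mem_iUnion, Set.mem_inter_iff, Set.mem_singleton_iff]
    constructor
    · intro h
      exact ⟨P.batch t ω, rfl, h⟩
    · rintro ⟨J, rfl, h⟩
      exact h
  rw [this]
  refine MeasurableSet.iUnion fun J => ?_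
  refine (hP.measurable_batch t ht (measurableSet_singleton J)).inter ?_
  have hs : Measurable fun ω => fun i : J => P.sample ω i :=
    measurable_pi_lambda _ fun i => (measurable_pi_apply _).comp hP.measurable_sample
  exact hs (MeasurableSpace.measurableSet_iInf.1 hA J)

lemma history_le (hP : P.Conditions μ D R) {r : ℕ} (hr : r ≤ N) : P.history r ≤ mΩ := by
  refine sup_le (iSup₂_le fun t ht => ?_) (iSup₂_le fun t ht => ?_)
  · exact measurable_iff_comap_le.1 (hP.measurable_iter_stochGrad.1
      ((Nat.lt_succ_iff.1 (Finset.mem_range.1 ht)).trans hr))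
  · have ht' : t < N := (Finset.mem_range.1 ht).trans_le hr
    exact sup_le (sup_le (measurable_iff_comap_le.1 (hP.measurable_batch t ht'))
      (measurable_iff_comap_le.1 (hP.measurable_minibatch ht')))
      (measurable_iff_comap_le.1 (hP.measurable_iter_stochGrad.2 ht'))

lemma noiseField_le (hP : P.Conditions μ D R) {t : ℕ} (ht : t ≤ N) : P.noiseField t ≤ mΩ :=
  iSup₂_le fun k hk => measurable_iff_comap_le.1
    (hP.measurable_noise k ((Finset.mem_range.1 hk).trans_le ht))

lemma sampleField_le (hP : P.Conditions μ D R) : P.sampleField ≤ mΩ :=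
  measurable_iff_comap_le.1 hP.measurable_sample

lemma ghostField_le (hP : P.Conditions μ D R) :
    MeasurableSpace.comap P.ghost inferInstance ≤ mΩ :=
  measurable_iff_comap_le.1 hP.measurable_ghost

lemma fullField_le (hP : P.Conditions μ D R) {t : ℕ} (ht : t ≤ N) : P.fullField t ≤ mΩ :=
  sup_le (sup_le (sup_le (sup_le (hP.history_le le_rfl) hP.sampleField_le) hP.aux_le)
    (hP.noiseField_le ht)) hP.ghostField_le

lemma refField_le (hP : P.Conditions μ D R) {t : ℕ} (ht : t ≤ N) : P.refField t ≤ mΩ :=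
  (P.refField_le_fullField ht).trans (hP.fullField_le ht)

lemma measurable_cov_fullField (hP : P.Conditions μ D R) {k : ℕ} (t : ℕ) (hk : k < N) :
    Measurable[P.fullField t] (P.cov k) :=
  (matrixMeasurable_iff.1 (hP.predictable_cov k hk)).mono
    ((P.history_mono hk.le).trans (P.history_le_fullField t)) le_rfl

lemma measurable_accCov_fullField (hP : P.Conditions μ D R) {k : ℕ} (t : ℕ) (hk : k ≤ N) :
    Measurable[P.fullField t] (P.accCov k) := by
  rw [← matrixMeasurable_iff]
  intro i j
  have : (fun ω => P.accCov k ω i j) = fun ω => ∑ l ∈ Finset.range k, P.cov l ω i j := by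
    ext ω; simp [accCov, Matrix.sum_apply]
  rw [this]
  refine Finset.measurable_sum _ fun l hl => ?_
  exact matrixMeasurable_iff.2
    (hP.measurable_cov_fullField t ((Finset.mem_range.1 hl).trans_le hk)) i j

lemma posSemidef_accCov (hP : P.Conditions μ D R) {t : ℕ} (ht : t ≤ N) :
    ∀ᵐ ω ∂μ, (P.accCov t ω).PosSemidef := by
  have h : ∀ k ∈ Finset.range t, ∀ᵐ ω ∂μ, (P.cov k ω).PosDef :=
    fun k hk => hP.posDef_cov k ((Finset.mem_range.1 hk).trans_le ht)
  filter_upwards [(Filter.eventually_all_finset _).2 h] with ω hω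
  exact Matrix.posSemidef_sum _ fun k hk => (hω k hk).posSemidef

variable [IsProbabilityMeasure μ]

/-- The ghost sample may be added to the conditioning because it is independent of everything else,
the perturbation included. This lets both samples be frozen at once later on. -/
lemma hasCondDistrib_noise (hP : P.Conditions μ D R) {t : ℕ} (ht : t < N) :
    HasCondDistrib (P.noise t) (toCoarse (P.fullField t))
      (condGaussian (P.cov t) (hP.measurable_cov_fullField t ht)) μ := by
  have hH := hP.history_le (le_refl N)
  have hm : P.history N ⊔ P.sampleField ⊔ P.aux ⊔ P.noiseField t ≤ mΩ :=
    sup_le (sup_le (sup_le hH hP.sampleField_le) hP.aux_le) (hP.noiseField_le ht.le)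
  have hcov : Measurable[P.history N ⊔ P.sampleField ⊔ P.aux ⊔ P.noiseField t] (P.cov t) :=
    (matrixMeasurable_iff.1 (hP.predictable_cov t ht)).mono
      ((P.history_mono ht.le).trans (le_sup_of_le_left (le_sup_of_le_left le_sup_left))) le_rfl
  have h := (hP.law_noise t ht).hasCondDistrib (κ := condGaussian (P.cov t) hcov) hm
    (hP.measurable_noise t ht) (Filter.Eventually.of_forall fun ω => rfl)
  refine h.sup_of_indep hm hP.ghostField_le (hP.measurable_noise t ht)
    (indep_of_indep_of_le_left hP.indep_ghost ?_) fun ω => rfl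
  refine sup_le (sup_le (sup_le (sup_le ?_ ?_) ?_) ?_) ?_
  · exact le_sup_of_le_left (le_sup_of_le_left le_sup_right)
  · exact le_sup_of_le_left (le_sup_of_le_left le_sup_left)
  · exact le_sup_right
  · exact le_sup_of_le_left (le_sup_of_le_right (P.noiseField_mono ht.le))
  · exact le_sup_of_le_left (le_sup_of_le_right (P.comap_noise_le ht))

/-- `fullField 0` contains the entire real history, hence every covariance, but none of the
perturbations as generators. Conditionally on it the perturbations add up as independent Gaussians
with frozen covariances. -/
lemma hasCondDistrib_accNoise (hP : P.Conditions μ D R) {t : ℕ} (ht : t ≤ N) :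
    HasCondDistrib (P.accNoise t) (toCoarse (P.fullField 0))
      (condGaussian (P.accCov t) (hP.measurable_accCov_fullField 0 ht)) μ := by
  have hm := hP.fullField_le (Nat.zero_le N)
  induction t with
  | zero =>
    -- The empty sum of perturbations is 0, and the Gaussian with zero covariance is the Dirac mass
    -- there.
    have h0 : Measurable (P.accNoise 0) := by rw [accNoise_zero]; exact measurable_const
    refine (hasCondDistrib_toCoarse_iff hm h0).2 fun s hs A hA => ?_
    have hk : ∀ ω, condGaussian (P.accCov 0) (hP.measurable_accCov_fullField 0 ht)
        (toCoarse (P.fullField 0) ω) A = A.indicator 1 0 := by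
      intro ω
      have : condGaussian (P.accCov 0) (hP.measurable_accCov_fullField 0 ht)
        (toCoarse (P.fullField 0) ω) = multivariateGaussian 0 (P.accCov 0 ω) := rfl
      rw [this]
      simp only [accCov, Finset.range_zero, Finset.sum_empty]
      rw [multivariateGaussian_zero_cov, Measure.dirac_apply' _ hA]
    simp only [hk, accNoise_zero, lintegral_const, Measure.restrict_apply_univ]
    by_cases h : (0 : Param d) ∈ A <;> simp [h]
  | succ t ih =>
    have hX : Measurable[P.fullField t] (P.accNoise t) :=
      (P.measurable_virt_fullField le_rfl (by omega)).sub
        (P.measurable_iter_fullField t (by omega))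
    have hs : Measurable[P.fullField 0] fun ω => P.accCov t ω + P.cov t ω := by
      rw [← accCov_succ]; exact hP.measurable_accCov_fullField 0 ht
    have h := hasCondDistrib_add_gaussian (P.fullField_mono (Nat.zero_le t))
      (hP.fullField_le (by omega)) hX (hP.measurable_noise t ht)
      (hP.measurable_accCov_fullField 0 (by omega)) (hP.measurable_cov_fullField 0 ht)
      (hP.posSemidef_accCov (by omega))
      ((hP.posDef_cov t ht).mono fun _ h => h.posSemidef) (ih (by omega))
      (hP.hasCondDistrib_noise ht) hs
    simp only [accNoise_succ, accCov_succ]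
    exact h

end Conditions

end VirtualSGD

/-! ### Change of measure to the reference path. -/

namespace VirtualSGD

section Girsanov

open scoped ENNReal RealInnerProductSpace

variable {Ω 𝒵 : Type*} [mΩ : MeasurableSpace Ω] [MeasurableSpace 𝒵] {d n N : ℕ}

/-- The vector `η_t (G_t - ḡ(W̃_t))`, by which the actual update differs from the update along the
population gradient at the virtual iterate. -/
noncomputable def drift (P : VirtualSGD Ω 𝒵 d n N) (D : Measure 𝒵) (t : ℕ) (ω : Ω) : Param d :=
  P.rate t • (P.stochGrad t ω - popGrad P.loss D (P.virt t ω))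

/-- The direction `Σ_t⁻¹ η_t (G_t - ḡ(W̃_t))` of the exponential tilt at time `t`. -/
noncomputable def tilt (P : VirtualSGD Ω 𝒵 d n N) (D : Measure 𝒵) (t : ℕ) (ω : Ω) : Param d :=
  Matrix.toEuclideanCLM (𝕜 := ℝ) (P.cov t ω)⁻¹ (P.drift D t ω)

/-- The variance of the exponential tilt at time `t`. -/
noncomputable def energy (P : VirtualSGD Ω 𝒵 d n N) (D : Measure 𝒵) (t : ℕ) (ω : Ω) : ℝ :=
  ⟪P.tilt D t ω, Matrix.toEuclideanCLM (𝕜 := ℝ) (P.cov t ω) (P.tilt D t ω)⟫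

/-- The logarithm of the likelihood ratio of the reference path against the virtual path. -/
noncomputable def logRatio (P : VirtualSGD Ω 𝒵 d n N) (D : Measure 𝒵) (t : ℕ) (ω : Ω) : ℝ :=
  ∑ k ∈ Finset.range t, (⟪P.noise k ω, P.tilt D k ω⟫ - P.energy D k ω / 2)

/-- The likelihood ratio of the reference path against the virtual path. -/
noncomputable def ratio (P : VirtualSGD Ω 𝒵 d n N) (D : Measure 𝒵) (t : ℕ) (ω : Ω) : ℝ≥0∞ :=
  ENNReal.ofReal (Real.exp (P.logRatio D t ω))

variable {P : VirtualSGD Ω 𝒵 d n N} {μ : Measure Ω} {D : Measure 𝒵} [IsProbabilityMeasure D]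
  {R : ℝ≥0}

lemma logRatio_succ (t : ℕ) (ω : Ω) : P.logRatio D (t + 1) ω =
    P.logRatio D t ω + (⟪P.noise t ω, P.tilt D t ω⟫ - P.energy D t ω / 2) :=
  Finset.sum_range_succ _ _

lemma cov_mul_tilt {t : ℕ} {ω : Ω} (h : (P.cov t ω).PosDef) :
    Matrix.toEuclideanCLM (𝕜 := ℝ) (P.cov t ω) (P.tilt D t ω) = P.drift D t ω := by
  rw [tilt, ← ContinuousLinearMap.comp_apply, ← ContinuousLinearMap.mul_def, ← map_mul,
    Matrix.mul_nonsing_inv _ ((Matrix.isUnit_iff_isUnit_det _).1 h.isUnit), map_one]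
  rfl

lemma energy_eq {t : ℕ} {ω : Ω} (h : (P.cov t ω).PosDef) :
    P.energy D t ω = sqNormIn (P.precision t ω) (P.drift D t ω) := by
  rw [energy, cov_mul_tilt h, tilt, real_inner_comm, Matrix.inner_toEuclideanCLM]
  rfl

lemma measurable_toEuclideanCLM_apply {m : MeasurableSpace Ω}
    {M : Ω → Matrix (Fin d) (Fin d) ℝ} {x : Ω → Param d} (hM : Measurable[m] M)
    (hx : Measurable[m] x) :
    Measurable[m] fun ω => Matrix.toEuclideanCLM (𝕜 := ℝ) (M ω) (x ω) := by
  have hc : Continuous fun p : Matrix (Fin d) (Fin d) ℝ × Param d =>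
      (WithLp.toLp 2 (p.1.mulVec p.2.ofLp) : Param d) :=
    (PiLp.continuous_toLp 2 _).comp
      (continuous_fst.matrix_mulVec ((PiLp.continuous_ofLp 2 _).comp continuous_snd))
  have h : (fun ω => Matrix.toEuclideanCLM (𝕜 := ℝ) (M ω) (x ω)) =
      fun ω => (WithLp.toLp 2 ((M ω).mulVec (x ω).ofLp) : Param d) := rfl
  rw [h]
  exact hc.measurable.comp (hM.prodMk hx)

namespace Conditions

lemma measurable_popGrad (hP : P.Conditions μ D R) : Measurable (popGrad P.loss D) :=
  _root_.measurable_popGrad hP.measurable_loss hP.differentiable_loss D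

lemma measurable_drift (hP : P.Conditions μ D R) {k t : ℕ} (hk : k ≤ t) (hkN : k < N)
    (ht : t ≤ N) : Measurable[P.fullField t] (P.drift D k) := by
  have h1 := P.measurable_stochGrad_fullField t hkN
  have h2 : Measurable[P.fullField t] fun ω => popGrad P.loss D (P.virt k ω) :=
    hP.measurable_popGrad.comp (P.measurable_virt_fullField hk ht)
  have h3 : Measurable[P.fullField t] fun ω =>
      P.rate k • (P.stochGrad k ω - popGrad P.loss D (P.virt k ω)) :=
    (h1.sub h2).const_smul (P.rate k)
  exact h3

lemma measurable_tilt (hP : P.Conditions μ D R) {k t : ℕ} (hk : k ≤ t) (hkN : k < N)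
    (ht : t ≤ N) : Measurable[P.fullField t] (P.tilt D k) := by
  have h1 : Measurable[P.fullField t] fun ω => (P.cov k ω)⁻¹ :=
    Matrix.measurable_inv.comp (hP.measurable_cov_fullField t hkN)
  exact measurable_toEuclideanCLM_apply h1 (hP.measurable_drift hk hkN ht)

lemma measurable_energy (hP : P.Conditions μ D R) {k t : ℕ} (hk : k ≤ t) (hkN : k < N)
    (ht : t ≤ N) : Measurable[P.fullField t] (P.energy D k) := by
  have h1 := hP.measurable_tilt hk hkN ht
  have h2 := measurable_toEuclideanCLM_apply (hP.measurable_cov_fullField t hkN) h1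
  exact (continuous_inner.measurable).comp (h1.prodMk h2)

lemma measurable_logRatio (hP : P.Conditions μ D R) {t : ℕ} (ht : t ≤ N) :
    Measurable[P.fullField t] (P.logRatio D t) := by
  refine Finset.measurable_sum _ fun k hk => ?_
  have hk' := Finset.mem_range.1 hk
  have h1 := hP.measurable_tilt hk'.le (hk'.trans_le ht) ht
  exact ((continuous_inner (𝕜 := ℝ) (E := Param d)).measurable.comp
    ((P.measurable_noise_fullField hk').prodMk h1)).sub
    ((hP.measurable_energy hk'.le (hk'.trans_le ht) ht).div_const 2)

lemma measurable_ratio (hP : P.Conditions μ D R) {t : ℕ} (ht : t ≤ N) :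
    Measurable[P.fullField t] (P.ratio D t) :=
  (Real.measurable_exp.comp (hP.measurable_logRatio ht)).ennreal_ofReal

variable [IsProbabilityMeasure μ]

/-- One Girsanov step. Given `fullField t`, the old ratio, the tilt and the energy are constants, so
the new factor is a Cameron–Martin density for `N(0, Σ_t)`; its shift is `Σ_t` applied to the tilt,
which is the drift. -/
lemma lintegral_ratio_succ (hP : P.Conditions μ D R) {t : ℕ} (ht : t < N)
    {g : Coarse (P.fullField t) × Param d → ℝ≥0∞} (hg : Measurable g) :
    ∫⁻ ω, P.ratio D (t + 1) ω * g (toCoarse _ ω, P.noise t ω) ∂μ =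
      ∫⁻ ω, P.ratio D t ω * ∫⁻ x, g (toCoarse _ ω, x + P.drift D t ω)
        ∂(multivariateGaussian 0 (P.cov t ω)) ∂μ := by
  have hv : Measurable fun ω : Coarse (P.fullField t) => P.tilt D t ω :=
    hP.measurable_tilt le_rfl ht ht.le
  have he : Measurable fun ω : Coarse (P.fullField t) => P.energy D t ω :=
    hP.measurable_energy le_rfl ht ht.le
  have hr : Measurable fun ω : Coarse (P.fullField t) => P.ratio D t ω :=
    hP.measurable_ratio ht.le
  let W : Coarse (P.fullField t) × Param d → ℝ≥0∞ := fun p =>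
    ENNReal.ofReal (Real.exp (⟪p.2, P.tilt D t p.1⟫ - P.energy D t p.1 / 2))
  have hW : Measurable W :=
    (Real.measurable_exp.comp ((continuous_inner.measurable.comp
      (measurable_snd.prodMk (hv.comp measurable_fst))).sub
      ((he.comp measurable_fst).div_const 2))).ennreal_ofReal
  have hF : Measurable fun p : Coarse (P.fullField t) × Param d =>
      P.ratio D t p.1 * (W p * g p) := (hr.comp measurable_fst).mul (hW.mul hg)
  have h := (hP.hasCondDistrib_noise ht).lintegral_toCoarse (hP.fullField_le ht.le) hF
  have h1 : ∀ ω, P.ratio D (t + 1) ω * g (toCoarse _ ω, P.noise t ω) =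
      P.ratio D t (toCoarse (P.fullField t) ω) *
        (W (toCoarse _ ω, P.noise t ω) * g (toCoarse _ ω, P.noise t ω)) := by
    intro ω
    rw [← mul_assoc]
    congr 1
    change _ = ENNReal.ofReal _ * ENNReal.ofReal _
    rw [← ENNReal.ofReal_mul (Real.exp_nonneg _), ← Real.exp_add, ratio, logRatio_succ]
    rfl
  simp only [h1]
  rw [h]
  refine lintegral_congr_ae ?_
  filter_upwards [hP.posDef_cov t ht] with ω hω
  change ∫⁻ x, P.ratio D t ω * (W (toCoarse _ ω, x) * g (toCoarse _ ω, x))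
    ∂(multivariateGaussian 0 (P.cov t ω)) = _
  have hgω : Measurable fun x => g (toCoarse (P.fullField t) ω, x) :=
    hg.comp measurable_prodMk_left
  have hWω : Measurable fun x => W (toCoarse (P.fullField t) ω, x) :=
    hW.comp measurable_prodMk_left
  have hWg : Measurable fun x => W (toCoarse (P.fullField t) ω, x) *
      g (toCoarse (P.fullField t) ω, x) := hWω.mul hgω
  rw [lintegral_const_mul _ hWg]
  congr 1
  have h2 := lintegral_exp_mul_multivariateGaussian hω.posSemidef (P.tilt D t ω) hgω
  conv_rhs at h2 => rw [cov_mul_tilt hω]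
  rw [← h2]
  rfl

lemma lintegral_ratio (hP : P.Conditions μ D R) {t : ℕ} (ht : t ≤ N) :
    ∫⁻ ω, P.ratio D t ω ∂μ = 1 := by
  induction t with
  | zero => simp [ratio, logRatio]
  | succ t ih =>
    have h := hP.lintegral_ratio_succ (g := fun _ => 1) ht measurable_const
    simp only [mul_one, lintegral_const, measure_univ] at h
    rw [h, ih (by omega)]

/-- The law of the reference path. -/
noncomputable abbrev refMeasure (_hP : P.Conditions μ D R) (t : ℕ) : Measure Ω :=
  μ.withDensity (P.ratio D t)

lemma isProbabilityMeasure_refMeasure (hP : P.Conditions μ D R) {t : ℕ} (ht : t ≤ N) :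
    IsProbabilityMeasure (hP.refMeasure t) :=
  ⟨by rw [withDensity_apply _ MeasurableSet.univ, setLIntegral_univ, hP.lintegral_ratio ht]⟩

omit [IsProbabilityMeasure μ] in
lemma measurable_refTransition (hP : P.Conditions μ D R) {t : ℕ}
    {M : Ω → Matrix (Fin d) (Fin d) ℝ} (hM : MatrixMeasurable (P.refField t) M)
    {B : Set (Param d)} (hB : MeasurableSet B) :
    Measurable[P.refField t] fun ω => ∫⁻ x, B.indicator (1 : Param d → ℝ≥0∞)
      (P.virt t ω - P.rate t • popGrad P.loss D (P.virt t ω) + x)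
      ∂(multivariateGaussian 0 (M ω)) := by
  have hv : Measurable fun ω : Coarse (P.refField t) => P.virt t ω :=
    P.measurable_virt_refField le_rfl
  have hg : Measurable fun ω : Coarse (P.refField t) => popGrad P.loss D (P.virt t ω) :=
    hP.measurable_popGrad.comp hv
  have hb : Measurable fun ω : Coarse (P.refField t) =>
      P.virt t ω - P.rate t • popGrad P.loss D (P.virt t ω) := hv.sub (hg.const_smul (P.rate t))
  have hB1 : Measurable (B.indicator (1 : Param d → ℝ≥0∞)) := measurable_one.indicator hB
  exact Measurable.lintegral_kernel_prod_right
    (κ := condGaussian (m := P.refField t) M (matrixMeasurable_iff.1 hM))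
    (f := fun (ω : Coarse (P.refField t)) (x : Param d) => B.indicator (1 : Param d → ℝ≥0∞)
      (P.virt t ω - P.rate t • popGrad P.loss D (P.virt t ω) + x))
    (hB1.comp ((hb.comp measurable_fst).add measurable_snd))

/-- The Markov transition of the virtual path under the tilted measure. Both the mean and, through
`M`, the covariance on the right depend on reference-visible data only. -/
lemma lintegral_refMeasure_succ (hP : P.Conditions μ D R) {t : ℕ} (ht : t < N)
    {M : Ω → Matrix (Fin d) (Fin d) ℝ} (hM : P.IsSyncReference μ t M)
    {A : Set Ω} (hA : MeasurableSet[P.refField t] A) {B : Set (Param d)} (hB : MeasurableSet B)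
    {C : Set Ω} (hC : MeasurableSet[P.sampleField] C) :
    hP.refMeasure (t + 1) ((A ∩ P.virt (t + 1) ⁻¹' B) ∩ C) =
      ∫⁻ ω in C, A.indicator 1 ω * ∫⁻ x, B.indicator 1
        (P.virt t ω - P.rate t • popGrad P.loss D (P.virt t ω) + x)
        ∂(multivariateGaussian 0 (M ω)) ∂(hP.refMeasure t) := by
  have hAf : MeasurableSet[P.fullField t] A := P.refField_le_fullField ht.le _ hA
  have hCf : MeasurableSet[P.fullField t] C := P.sampleField_le_fullField t _ hC
  have hle := hP.fullField_le ht.le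
  have hB1 : Measurable (B.indicator (1 : Param d → ℝ≥0∞)) := measurable_one.indicator hB
  have hv : Measurable (P.virt (t + 1)) :=
    (P.measurable_virt_fullField le_rfl ht).mono (hP.fullField_le ht) le_rfl
  have hset : MeasurableSet ((A ∩ P.virt (t + 1) ⁻¹' B) ∩ C) :=
    ((hle _ hAf).inter (hv hB)).inter (hle _ hCf)
  have ha : Measurable fun ω : Coarse (P.fullField t) => P.virt t ω - P.rate t • P.stochGrad t ω :=
    (P.measurable_virt_fullField le_rfl ht.le).sub
      ((P.measurable_stochGrad_fullField t ht).const_smul (P.rate t))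
  let g : Coarse (P.fullField t) × Param d → ℝ≥0∞ := fun p =>
    Set.indicator (α := Coarse (P.fullField t)) (A ∩ C) (fun _ => 1) p.1 *
      B.indicator 1 (P.virt t p.1 - P.rate t • P.stochGrad t p.1 + p.2)
  have hg : Measurable g := by
    have hAC : MeasurableSet (α := Coarse (P.fullField t)) (A ∩ C) := MeasurableSet.inter hAf hCf
    exact ((measurable_const.indicator hAC).comp measurable_fst).mul
      (hB1.comp ((ha.comp measurable_fst).add measurable_snd))
  have h := hP.lintegral_ratio_succ (D := D) ht hg
  have hr1 : Measurable (P.ratio D (t + 1)) := (hP.measurable_ratio ht).mono (hP.fullField_le ht) le_rfl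
  have hr : Measurable (P.ratio D t) := (hP.measurable_ratio ht.le).mono hle le_rfl
  rw [withDensity_apply _ hset, ← lintegral_indicator hset]
  have e1 : ∫⁻ ω, ((A ∩ P.virt (t + 1) ⁻¹' B) ∩ C).indicator (P.ratio D (t + 1)) ω ∂μ =
      ∫⁻ ω, P.ratio D (t + 1) ω * g (toCoarse _ ω, P.noise t ω) ∂μ := by
    refine lintegral_congr fun ω => ?_
    change _ = P.ratio D (t + 1) ω * ((A ∩ C).indicator (fun _ => 1) ω *
      B.indicator 1 (P.virt (t + 1) ω))
    by_cases h1 : ω ∈ A <;> by_cases h2 : ω ∈ C <;> by_cases h3 : P.virt (t + 1) ω ∈ B <;>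
      simp [h1, h2, h3]
  rw [e1, h, restrict_withDensity (hle _ hCf)]
  have hk : Measurable[P.refField t] fun ω => ∫⁻ x, B.indicator 1
        (P.virt t ω - P.rate t • popGrad P.loss D (P.virt t ω) + x)
        ∂(multivariateGaussian 0 (M ω)) :=
    hP.measurable_refTransition hM.measurable hB
  have hAk : Measurable fun ω => A.indicator (1 : Ω → ℝ≥0∞) ω * ∫⁻ x, B.indicator 1
        (P.virt t ω - P.rate t • popGrad P.loss D (P.virt t ω) + x)
        ∂(multivariateGaussian 0 (M ω)) :=
    (measurable_one.indicator (hle _ hAf)).mul (hk.mono (hP.refField_le ht.le) le_rfl)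
  rw [lintegral_withDensity_eq_lintegral_mul _ hr hAk, ← lintegral_indicator (hle _ hCf)]
  refine lintegral_congr_ae ?_
  filter_upwards [hM.eq_cov] with ω hω
  change P.ratio D t ω * ∫⁻ x, (A ∩ C).indicator (fun _ => 1) ω *
      B.indicator 1 (P.virt t ω - P.rate t • P.stochGrad t ω + (x + P.drift D t ω))
      ∂(multivariateGaussian 0 (P.cov t ω)) = _
  rw [lintegral_const_mul _ (by fun_prop)]
  -- The training gradient cancels against the drift; this is what the tilt was chosen for.
  have e2 : ∀ x, P.virt t ω - P.rate t • P.stochGrad t ω + (x + P.drift D t ω) =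
      P.virt t ω - P.rate t • popGrad P.loss D (P.virt t ω) + x := fun x => by
    rw [drift, smul_sub]; abel
  simp only [e2, ← hω]
  by_cases h1 : ω ∈ A <;> by_cases h2 : ω ∈ C <;> simp [h1, h2]

/-- Independence of the reference sigma-field and the sample under the tilted measure, phrased as an
equality of restricted measures so that it can be integrated against. The start is the independence
of initialization and auxiliary randomness from the sample; each step propagates it because the
transition is `refField t`-measurable. -/
lemma trim_refMeasure_restrict (hP : P.Conditions μ D R)
    (hsync : ∀ t < N, ∃ M, P.IsSyncReference μ t M) {t : ℕ} (ht : t ≤ N)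
    {C : Set Ω} (hC : MeasurableSet[P.sampleField] C) :
    ((hP.refMeasure t).restrict C).trim (hP.refField_le ht) =
      (μ C • hP.refMeasure t).trim (hP.refField_le ht) := by
  have hCm := hP.sampleField_le _ hC
  have := hP.isProbabilityMeasure_refMeasure ht
  induction t with
  | zero =>
    refine @Measure.ext Ω (P.refField 0) _ _ fun A hA => ?_
    have hAm := hP.refField_le ht _ hA
    rw [trim_measurableSet_eq _ hA, trim_measurableSet_eq _ hA, Measure.restrict_apply hAm]
    have h1 : P.ratio D 0 = 1 := by ext1 ω; simp [ratio, logRatio]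
    simp only [refMeasure, h1, withDensity_one, Measure.smul_apply, smul_eq_mul]
    rw [refField_zero] at hA
    rw [(Indep_iff _ _ μ).1 hP.indep_init_aux A C hA hC, mul_comm]
  | succ t ih =>
    obtain ⟨M, hM⟩ := hsync t ht
    have hle := hP.refField_le ht
    have ih' := ih (by omega) (hP.isProbabilityMeasure_refMeasure (by omega))
    have hset : ∀ s, MeasurableSet[P.refField (t + 1)] s →
        s ∈ interSets (P.refField t)
          (MeasurableSpace.comap (P.virt (t + 1)) inferInstance) →
        ((hP.refMeasure (t + 1)).restrict C).trim hle s =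
          (μ C • hP.refMeasure (t + 1)).trim hle s := by
      rintro _ hs ⟨A, _, hA, ⟨B, hB, rfl⟩, rfl⟩
      rw [trim_measurableSet_eq _ hs, trim_measurableSet_eq _ hs,
        Measure.restrict_apply (hle _ hs), Measure.smul_apply, smul_eq_mul,
        hP.lintegral_refMeasure_succ ht hM hA hB hC]
      have h2 := hP.lintegral_refMeasure_succ ht hM hA hB (MeasurableSet.univ)
      rw [Set.inter_univ, Measure.restrict_univ] at h2
      rw [h2]
      have hk : Measurable[P.refField t] fun ω => A.indicator (1 : Ω → ℝ≥0∞) ω *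
        ∫⁻ x, B.indicator 1
        (P.virt t ω - P.rate t • popGrad P.loss D (P.virt t ω) + x)
        ∂(multivariateGaussian 0 (M ω)) :=
        (Measurable.indicator (α := Coarse (P.refField t)) measurable_one hA).mul (hP.measurable_refTransition hM.measurable hB)
      -- Synchronization enters here: measurability of the integrand with respect to `refField t`
      -- permits passing to the trimmed measure, where the induction hypothesis applies.
      rw [← lintegral_trim (hP.refField_le (by omega)) hk, ih', lintegral_trim _ hk,
        lintegral_smul_measure, smul_eq_mul]
    refine @ext_of_generate_finite Ω (P.refField (t + 1)) _ _ _
      ((P.refField_succ t).trans (sup_eq_generateFrom_interSets _ _))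
      (isPiSystem_interSets _ _) inferInstance (fun s hs => ?_) ?_
    · refine hset s ?_ hs
      rw [refField_succ, sup_eq_generateFrom_interSets]
      exact MeasurableSpace.measurableSet_generateFrom hs
    · exact hset _ MeasurableSet.univ
        ⟨Set.univ, Set.univ, MeasurableSet.univ, MeasurableSet.univ, (Set.inter_univ _).symm⟩

/-- Along the reference path, the virtual output is independent of the sample. -/
lemma map_refMeasure_virt_sample (hP : P.Conditions μ D R)
    (hsync : ∀ t < N, ∃ M, P.IsSyncReference μ t M) :
    (hP.refMeasure N).map (fun ω => (P.virt N ω, P.sample ω)) =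
      ((hP.refMeasure N).map (P.virt N)).prod (Measure.pi fun _ => D) := by
  have := hP.isProbabilityMeasure_refMeasure le_rfl
  have hv : Measurable (P.virt N) :=
    (P.measurable_virt_refField le_rfl).mono (hP.refField_le le_rfl) le_rfl
  have : IsProbabilityMeasure ((hP.refMeasure N).map (P.virt N)) :=
    Measure.isProbabilityMeasure_map hv.aemeasurable
  refine (Measure.prod_eq fun B C hB hC => ?_).symm
  have hCs : MeasurableSet[P.sampleField] (P.sample ⁻¹' C) := ⟨C, hC, rfl⟩
  have hBs : MeasurableSet[P.refField N] (P.virt N ⁻¹' B) := P.measurable_virt_refField le_rfl hB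
  have h := congrFun (congrArg (fun ν : @Measure Ω (P.refField N) => (ν : Set Ω → ℝ≥0∞))
    (hP.trim_refMeasure_restrict hsync le_rfl hCs)) (P.virt N ⁻¹' B)
  rw [trim_measurableSet_eq _ hBs, trim_measurableSet_eq _ hBs,
    Measure.restrict_apply (hv hB), Measure.smul_apply, smul_eq_mul] at h
  rw [Measure.map_apply (hv.prodMk hP.measurable_sample) (hB.prod hC), Measure.map_apply hv hB,
    ← hP.law_sample, Measure.map_apply hP.measurable_sample hC, mul_comm, ← h]
  rfl

end Conditions

end Girsanov

end VirtualSGD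

/-! ### A transport inequality from exponential moments. -/

section Variational

open scoped ENNReal

variable {Ω : Type*} [MeasurableSpace Ω] {μ : Measure Ω} [IsProbabilityMeasure μ]

/-- A form of the Donsker–Varadhan transport inequality: if `exp L` is a likelihood ratio with
relative entropy at most `K`, under which `F` has sub-Gaussian exponential moments, then the mean
of `F` is bounded. -/
lemma integrable_and_abs_integral_le_of_lintegral_exp_le {F L : Ω → ℝ} {K b : ℝ}
    (hF : Measurable F) (hLm : Measurable L) (hL : Integrable L μ) (hK : -K ≤ ∫ ω, L ω ∂μ)
    (h : ∀ l : ℝ, ∫⁻ ω, ENNReal.ofReal (Real.exp (L ω)) * ENNReal.ofReal (Real.exp (l * F ω)) ∂μ ≤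
      ENNReal.ofReal (Real.exp (l ^ 2 * b))) :
    Integrable F μ ∧ |∫ ω, F ω ∂μ| ≤ √(4 * b * K) := by
  have he : ∀ l : ℝ, Integrable (fun ω => Real.exp (L ω + l * F ω)) μ ∧
      ∫ ω, Real.exp (L ω + l * F ω) ∂μ ≤ Real.exp (l ^ 2 * b) := by
    intro l
    have h1 : ∀ ω, ENNReal.ofReal (Real.exp (L ω)) * ENNReal.ofReal (Real.exp (l * F ω)) =
        ENNReal.ofReal (Real.exp (L ω + l * F ω)) := fun ω => by
      rw [Real.exp_add, ENNReal.ofReal_mul (Real.exp_nonneg _)]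
    have h2 := h l
    simp only [h1] at h2
    have hm : Measurable fun ω => Real.exp (L ω + l * F ω) :=
      Real.measurable_exp.comp (hLm.add (hF.const_mul l))
    have hint : Integrable (fun ω => Real.exp (L ω + l * F ω)) μ := by
      refine ⟨hm.aestronglyMeasurable, ?_⟩
      rw [hasFiniteIntegral_iff_ofReal (Filter.Eventually.of_forall fun _ => Real.exp_nonneg _)]
      exact h2.trans_lt ENNReal.ofReal_lt_top
    refine ⟨hint, ?_⟩
    rw [← ofReal_integral_eq_lintegral_ofReal hint
      (Filter.Eventually.of_forall fun _ => Real.exp_nonneg _)] at h2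
    exact (ENNReal.ofReal_le_ofReal_iff (Real.exp_nonneg _)).1 h2
  -- From `x + 1 ≤ exp x` at `L ± F`, one gets `|F| ≤ exp (L + F) + exp (L - F) + |L|`.
  have hFi : Integrable F μ := by
    refine Integrable.mono' (((he 1).1.add (he (-1)).1).add hL.norm) hF.aestronglyMeasurable
      (Filter.Eventually.of_forall fun ω => ?_)
    simp only [Pi.add_apply, Real.norm_eq_abs]
    have e1 := Real.add_one_le_exp (L ω + 1 * F ω)
    have e2 := Real.add_one_le_exp (L ω + -1 * F ω)
    have p1 := Real.exp_pos (L ω + 1 * F ω)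
    have p2 := Real.exp_pos (L ω + -1 * F ω)
    have n1 := neg_abs_le (L ω)
    rcases abs_cases (F ω) with ⟨h, _⟩ | ⟨h, _⟩ <;> linarith
  refine ⟨hFi, ?_⟩
  -- Integrating `x ≤ exp x - 1` at `x = L + l F - l² b` replaces Jensen's inequality. A quadratic
  -- in `l` that is nonnegative everywhere has nonpositive discriminant, which is the claim and
  -- optimizes over `l` for both signs at once.
  have hquad : ∀ l : ℝ, 0 ≤ b * (l * l) + (-∫ ω, F ω ∂μ) * l + K := by
    intro l
    obtain ⟨hi, hle⟩ := he l
    have h1 : ∫ ω, (L ω + l * F ω - l ^ 2 * b) ∂μ ≤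
        ∫ ω, (Real.exp (L ω + l * F ω) * Real.exp (-(l ^ 2 * b)) - 1) ∂μ := by
      refine integral_mono ((hL.add (hFi.const_mul l)).sub (integrable_const _))
        ((hi.mul_const _).sub (integrable_const _)) fun ω => ?_
      have := Real.add_one_le_exp (L ω + l * F ω - l ^ 2 * b)
      rw [sub_eq_add_neg, Real.exp_add] at this
      simp only
      linarith
    have h2 : ∫ ω, (L ω + l * F ω - l ^ 2 * b) ∂μ =
        ∫ ω, L ω ∂μ + l * ∫ ω, F ω ∂μ - l ^ 2 * b := by
      have hadd : Integrable (fun ω => L ω + l * F ω) μ := hL.add (hFi.const_mul l)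
      rw [integral_sub hadd (integrable_const _), integral_add hL (hFi.const_mul l), integral_const_mul]
      simp
    have h3 : ∫ ω, (Real.exp (L ω + l * F ω) * Real.exp (-(l ^ 2 * b)) - 1) ∂μ ≤ 0 := by
      rw [integral_sub (hi.mul_const _) (integrable_const _), integral_mul_const]
      have := mul_le_mul_of_nonneg_right hle (Real.exp_nonneg (-(l ^ 2 * b)))
      rw [← Real.exp_add, add_neg_cancel, Real.exp_zero] at this
      simpa using this
    nlinarith
  refine Real.abs_le_sqrt ?_
  have := discrim_le_zero hquad
  rw [discrim] at this
  nlinarith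

end Variational

/-! ### Sub-Gaussian moments, relative entropy and the bound at the virtual output. -/

namespace VirtualSGD

open scoped ENNReal RealInnerProductSpace

variable {Ω 𝒵 : Type*} [mΩ : MeasurableSpace Ω] [MeasurableSpace 𝒵] {d n N : ℕ}

/-- The centered empirical risk `E ℓ(w, Z) - L(w, s)`. -/
noncomputable def centeredRisk (loss : Param d → 𝒵 → ℝ) (D : Measure 𝒵)
    (p : Param d × (Fin n → 𝒵)) : ℝ :=
  (∫ z, loss p.1 z ∂D) - empRisk loss p.1 p.2

variable {P : VirtualSGD Ω 𝒵 d n N} {μ : Measure Ω} {D : Measure 𝒵} [IsProbabilityMeasure D]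
  {R : ℝ≥0}

namespace Conditions

lemma measurable_centeredRisk (hP : P.Conditions μ D R) :
    Measurable (centeredRisk (n := n) P.loss D) :=
  ((hP.measurable_loss.stronglyMeasurable.integral_prod_right').measurable.comp
    measurable_fst).sub (measurable_empRisk hP.measurable_loss)

/-- A sum of n independent centered losses has variance proxy `n R²`; at scale `-l / n` the exponent
is `(l / n)² n R² / 2 = l² R² / (2 n)`. -/
lemma lintegral_exp_centeredRisk_pi_le (hP : P.Conditions μ D R) (w : Param d) (l : ℝ) :
    ∫⁻ s : Fin n → 𝒵, ENNReal.ofReal (Real.exp (l * centeredRisk P.loss D (w, s)))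
      ∂(Measure.pi fun _ => D) ≤ ENNReal.ofReal (Real.exp (l ^ 2 * (R ^ 2 / (2 * n)))) := by
  have hn : (0 : ℝ) < n := Nat.cast_pos.2 hP.size_pos
  let Y : 𝒵 → ℝ := fun z => P.loss w z - ∫ z', P.loss w z' ∂D
  have hYm : Measurable Y := (hP.measurable_loss.comp measurable_prodMk_left).sub_const _
  have hsub : ∀ i : Fin n, HasSubgaussianMGF (fun s : Fin n → 𝒵 => Y (s i)) (R ^ 2)
      (Measure.pi fun _ => D) := by
    intro i
    have hmp := measurePreserving_eval (fun _ : Fin n => D) i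
    have hY : HasSubgaussianMGF Y (R ^ 2) ((Measure.pi fun _ : Fin n => D).map
        (Function.eval i)) := by
      rw [hmp.map_eq]; exact hP.subGaussian_loss w
    exact hY.of_map hmp.measurable.aemeasurable
  have hind : iIndepFun (fun (i : Fin n) (s : Fin n → 𝒵) => Y (s i)) (Measure.pi fun _ => D) :=
    iIndepFun_pi fun _ => hYm.aemeasurable
  have hsum := HasSubgaussianMGF.sum_of_iIndepFun hind (s := Finset.univ) fun i _ => hsub i
  have he : ∀ s : Fin n → 𝒵, l * centeredRisk P.loss D (w, s) = (-(l / n)) * ∑ i, Y (s i) := by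
    intro s
    simp only [centeredRisk, empRisk, Y, Finset.sum_sub_distrib, Finset.sum_const,
      Finset.card_univ, Fintype.card_fin, nsmul_eq_mul]
    field_simp
    ring
  simp only [he]
  rw [← ofReal_integral_eq_lintegral_ofReal (hsum.integrable_exp_mul _)
    (Filter.Eventually.of_forall fun _ => Real.exp_nonneg _)]
  refine ENNReal.ofReal_le_ofReal ((hsum.mgf_le (-(l / n))).trans (Real.exp_le_exp.2 (le_of_eq ?_)))
  simp only [Finset.sum_const, Finset.card_univ, Fintype.card_fin, nsmul_eq_mul]
  push_cast
  field_simp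

lemma lintegral_exp_centeredRisk_le (hP : P.Conditions μ D R) {ν : Measure Ω}
    [IsProbabilityMeasure ν] {X : Ω → Param d} {S : Ω → Fin n → 𝒵} (hX : Measurable X)
    (hS : Measurable S)
    (h : ν.map (fun ω => (X ω, S ω)) = (ν.map X).prod (Measure.pi fun _ => D)) (l : ℝ) :
    ∫⁻ ω, ENNReal.ofReal (Real.exp (l * centeredRisk P.loss D (X ω, S ω))) ∂ν ≤
      ENNReal.ofReal (Real.exp (l ^ 2 * (R ^ 2 / (2 * n)))) := by
  have hm : Measurable fun p : Param d × (Fin n → 𝒵) =>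
      ENNReal.ofReal (Real.exp (l * centeredRisk P.loss D p)) :=
    (Real.measurable_exp.comp (hP.measurable_centeredRisk.const_mul l)).ennreal_ofReal
  have : IsProbabilityMeasure (ν.map X) := Measure.isProbabilityMeasure_map hX.aemeasurable
  rw [← lintegral_map (f := fun p : Param d × (Fin n → 𝒵) =>
      ENNReal.ofReal (Real.exp (l * centeredRisk P.loss D p))) hm (hX.prodMk hS), h,
    lintegral_prod _ hm.aemeasurable]
  refine (lintegral_mono fun w => hP.lintegral_exp_centeredRisk_pi_le w l).trans ?_
  simp

variable [IsProbabilityMeasure μ]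

/-- The virtual path is built from history and perturbations alone, so it is measurable in the
sigma-field from which the ghost sample is independent. No change of measure is needed. -/
lemma map_virt_ghost (hP : P.Conditions μ D R) :
    μ.map (fun ω => (P.virt N ω, P.ghost ω)) = (μ.map (P.virt N)).prod (Measure.pi fun _ => D) := by
  have hv : Measurable (P.virt N) :=
    (P.measurable_virt_refField le_rfl).mono (hP.refField_le le_rfl) le_rfl
  have hv' : Measurable[P.sampleField ⊔ P.history N ⊔ P.noiseField N ⊔ P.aux] (P.virt N) := by
    have : ∀ k ≤ N, Measurable[P.sampleField ⊔ P.history N ⊔ P.noiseField N ⊔ P.aux]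
        (P.virt k) := by
      intro k hk
      have hH : P.history N ≤ P.sampleField ⊔ P.history N ⊔ P.noiseField N ⊔ P.aux :=
        le_sup_of_le_left (le_sup_of_le_left le_sup_right)
      induction k with
      | zero => exact (P.measurable_iter_history (Nat.zero_le N)).mono hH le_rfl
      | succ k ih =>
        have hG := (P.measurable_stochGrad_history hk).mono hH le_rfl
        have hE : Measurable[P.sampleField ⊔ P.history N ⊔ P.noiseField N ⊔ P.aux] (P.noise k) :=
          measurable_iff_comap_le.2 ((P.comap_noise_le hk).trans
            (le_sup_of_le_left le_sup_right))
        exact ((ih (by omega)).sub (hG.const_smul (P.rate k))).add hE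
    exact this N le_rfl
  have hind : IndepFun (P.virt N) P.ghost μ :=
    indep_of_indep_of_le_left hP.indep_ghost (measurable_iff_comap_le.1 hv')
  rw [(indepFun_iff_map_prod_eq_prod_map_map hv.aemeasurable
    hP.measurable_ghost.aemeasurable).1 hind, hP.law_ghost]

end Conditions

lemma sqNormIn_smul (M : Matrix (Fin d) (Fin d) ℝ) (r : ℝ) (x : Param d) :
    sqNormIn M (r • x) = r ^ 2 * sqNormIn M x := by
  simp only [sqNormIn, WithLp.ofLp_smul, Matrix.mulVec_smul, smul_dotProduct, dotProduct_smul,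
    smul_eq_mul]
  ring

lemma sqNormIn_nonneg {M : Matrix (Fin d) (Fin d) ℝ} (hM : M.PosSemidef) (x : Param d) :
    0 ≤ sqNormIn M x := by
  simpa [sqNormIn] using hM.dotProduct_mulVec_nonneg x.ofLp

/-- The parallelogram identity, dropping the term of `x + y`. -/
lemma sqNormIn_sub_le {M : Matrix (Fin d) (Fin d) ℝ} (hM : M.PosSemidef) (x y : Param d) :
    sqNormIn M (x - y) ≤ 2 * (sqNormIn M x + sqNormIn M y) := by
  have h := sqNormIn_nonneg hM (x + y)
  have e : sqNormIn M (x - y) + sqNormIn M (x + y) = 2 * (sqNormIn M x + sqNormIn M y) := by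
    simp only [sqNormIn, WithLp.ofLp_sub, WithLp.ofLp_add, Matrix.mulVec_sub, Matrix.mulVec_add,
      sub_dotProduct, add_dotProduct, dotProduct_sub, dotProduct_add]
    ring
  linarith

namespace Conditions

variable [IsProbabilityMeasure μ]

/-- The energy of the tilt is controlled by the gradient deviation and the gradient sensitivity. -/
lemma energy_le (hP : P.Conditions μ D R) {t : ℕ} (ht : t < N) :
    ∀ᵐ ω ∂μ, 0 ≤ P.energy D t ω ∧ P.energy D t ω ≤ 2 * P.rate t ^ 2 *
      (sqNormIn (P.precision t ω) (P.stochGrad t ω - popGrad P.loss D (P.iter t ω)) +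
        sqNormIn (P.precision t ω) (popGrad P.loss D (P.iter t ω + P.accNoise t ω) -
          popGrad P.loss D (P.iter t ω))) := by
  filter_upwards [hP.posDef_cov t ht] with ω hω
  have hp : (P.precision t ω).PosSemidef := hω.inv.posSemidef
  rw [energy_eq hω, drift, sqNormIn_smul, iter_add_accNoise]
  refine ⟨mul_nonneg (sq_nonneg _) (sqNormIn_nonneg hp _), ?_⟩
  -- The drift compares `G_t` with `ḡ` at the virtual iterate; inserting `ḡ(W_t)` separates
  -- deviation from sensitivity at the price of a factor 2.
  have h := sqNormIn_sub_le hp (P.stochGrad t ω - popGrad P.loss D (P.iter t ω))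
    (popGrad P.loss D (P.virt t ω) - popGrad P.loss D (P.iter t ω))
  rw [sub_sub_sub_cancel_right] at h
  have := mul_le_mul_of_nonneg_left h (sq_nonneg (P.rate t))
  linarith

lemma integrable_energy (hP : P.Conditions μ D R) {t : ℕ} (ht : t < N) :
    Integrable (P.energy D t) μ := by
  refine Integrable.mono' (((hP.integrable_deviation t ht).add
    (hP.integrable_sensitivity t ht)).const_mul (2 * P.rate t ^ 2))
    ((hP.measurable_energy le_rfl ht ht.le).mono (hP.fullField_le ht.le)
      le_rfl).aestronglyMeasurable ?_
  filter_upwards [hP.energy_le ht] with ω hω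
  rw [Real.norm_of_nonneg hω.1]
  exact hω.2

/-- Conditionally on `fullField t` this is a centered Gaussian variable whose variance is the
energy. Integrability of the energy gives square integrability, and the conditional mean vanishes.
-/
lemma integrable_inner_noise_tilt (hP : P.Conditions μ D R) {t : ℕ} (ht : t < N) :
    Integrable (fun ω => ⟪P.noise t ω, P.tilt D t ω⟫) μ ∧
      ∫ ω, ⟪P.noise t ω, P.tilt D t ω⟫ ∂μ = 0 := by
  have hle := hP.fullField_le ht.le
  have hv : Measurable fun ω : Coarse (P.fullField t) => P.tilt D t ω :=
    hP.measurable_tilt le_rfl ht ht.le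
  let F : Coarse (P.fullField t) × Param d → ℝ := fun p => ⟪p.2, P.tilt D t p.1⟫
  have hF : Measurable F :=
    measurable_snd.inner (hv.comp measurable_fst)
  have hlaw := hP.hasCondDistrib_noise ht
  have hm : Measurable fun ω => ⟪P.noise t ω, P.tilt D t ω⟫ :=
    (hP.measurable_noise t ht).inner ((hP.measurable_tilt le_rfl ht ht.le).mono hle le_rfl)
  have hsq : ∫⁻ ω, ENNReal.ofReal (⟪P.noise t ω, P.tilt D t ω⟫ ^ 2) ∂μ =
      ∫⁻ ω, ENNReal.ofReal (P.energy D t ω) ∂μ := by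
    have h := hlaw.lintegral_toCoarse hle (F := fun p => ENNReal.ofReal (F p ^ 2))
      (hF.pow_const 2).ennreal_ofReal
    refine Eq.trans h (lintegral_congr_ae ?_)
    filter_upwards [hP.posDef_cov t ht] with ω hω
    change ∫⁻ x, ENNReal.ofReal (⟪x, P.tilt D t ω⟫ ^ 2)
      ∂(multivariateGaussian 0 (P.cov t ω)) = _
    rw [← ofReal_integral_eq_lintegral_ofReal (integrable_inner_sq_multivariateGaussian _ _)
      (Filter.Eventually.of_forall fun _ => sq_nonneg _),
      integral_inner_sq_multivariateGaussian hω.posSemidef]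
    rfl
  have hL2 : MemLp (fun ω => ⟪P.noise t ω, P.tilt D t ω⟫) 2 μ := by
    refine (memLp_two_iff_integrable_sq hm.aestronglyMeasurable).2
      ⟨(hm.pow_const 2).aestronglyMeasurable, ?_⟩
    rw [hasFiniteIntegral_iff_ofReal (Filter.Eventually.of_forall fun _ => sq_nonneg _), hsq]
    exact (hP.integrable_energy (D := D) ht).lintegral_lt_top
  have hint := hL2.integrable one_le_two
  refine ⟨hint, ?_⟩
  have h := (hlaw.integral_toCoarse hle hF hint).2.2
  have h' : ∫ ω, ⟪P.noise t ω, P.tilt D t ω⟫ ∂μ =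
      ∫ ω, ∫ x, ⟪x, P.tilt D t ω⟫ ∂(multivariateGaussian 0 (P.cov t ω)) ∂μ := h
  simp only [h', integral_inner_multivariateGaussian, integral_zero]

/-- The entropy estimate: the linear terms have mean zero, leaving minus half the energies, and the
1/2 cancels the factor 2 of `energy_le`. -/
lemma integrable_logRatio (hP : P.Conditions μ D R) :
    Integrable (P.logRatio D N) μ ∧
      -(∑ t ∈ Finset.range N, P.rate t ^ 2 *
        (∫ ω, sqNormIn (P.precision t ω) (P.stochGrad t ω - popGrad P.loss D (P.iter t ω)) ∂μ +
          ∫ ω, sqNormIn (P.precision t ω) (popGrad P.loss D (P.iter t ω + P.accNoise t ω) -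
            popGrad P.loss D (P.iter t ω)) ∂μ)) ≤ ∫ ω, P.logRatio D N ω ∂μ := by
  have hi : ∀ t ∈ Finset.range N, Integrable
      (fun ω => ⟪P.noise t ω, P.tilt D t ω⟫ - P.energy D t ω / 2) μ := fun t ht =>
    (hP.integrable_inner_noise_tilt (Finset.mem_range.1 ht)).1.sub
      ((hP.integrable_energy (Finset.mem_range.1 ht)).div_const 2)
  refine ⟨integrable_finsetSum _ hi, ?_⟩
  simp only [logRatio]
  rw [integral_finsetSum _ hi, ← Finset.sum_neg_distrib]
  refine Finset.sum_le_sum fun t ht => ?_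
  have ht' := Finset.mem_range.1 ht
  obtain ⟨h1, h2⟩ := hP.integrable_inner_noise_tilt (D := D) ht'
  have hen := hP.integrable_energy (D := D) ht'
  rw [integral_sub h1 (hen.div_const 2), h2, integral_div]
  have h3 := integral_mono_ae hen (((hP.integrable_deviation t ht').add
    (hP.integrable_sensitivity t ht')).const_mul (2 * P.rate t ^ 2))
    ((hP.energy_le ht').mono fun ω h => h.2)
  rw [integral_const_mul] at h3
  simp only [Pi.add_apply] at h3
  rw [integral_add (hP.integrable_deviation t ht') (hP.integrable_sensitivity t ht')] at h3
  linarith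

/-- The generalization bound at the virtual output. -/
lemma virtual_bound (hP : P.Conditions μ D R) (hsync : ∀ t < N, ∃ M, P.IsSyncReference μ t M) :
    Integrable (fun ω => empRisk P.loss (P.virt N ω) (P.ghost ω) -
      empRisk P.loss (P.virt N ω) (P.sample ω)) μ ∧
    |∫ ω, (empRisk P.loss (P.virt N ω) (P.ghost ω) -
      empRisk P.loss (P.virt N ω) (P.sample ω)) ∂μ| ≤
      √(4 * (R : ℝ) ^ 2 / n * ∑ t ∈ Finset.range N, P.rate t ^ 2 *
        (∫ ω, sqNormIn (P.precision t ω) (P.stochGrad t ω - popGrad P.loss D (P.iter t ω)) ∂μ +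
          ∫ ω, sqNormIn (P.precision t ω) (popGrad P.loss D (P.iter t ω + P.accNoise t ω) -
            popGrad P.loss D (P.iter t ω)) ∂μ)) := by
  have hn : (0 : ℝ) < n := Nat.cast_pos.2 hP.size_pos
  have hv : Measurable (P.virt N) :=
    (P.measurable_virt_refField le_rfl).mono (hP.refField_le le_rfl) le_rfl
  have hr : Measurable (P.ratio D N) :=
    (hP.measurable_ratio le_rfl).mono (hP.fullField_le le_rfl) le_rfl
  have hLm : Measurable (P.logRatio D N) :=
    (hP.measurable_logRatio le_rfl).mono (hP.fullField_le le_rfl) le_rfl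
  have := hP.isProbabilityMeasure_refMeasure (D := D) (t := N) le_rfl
  have hS : Measurable fun ω => centeredRisk P.loss D (P.virt N ω, P.sample ω) :=
    hP.measurable_centeredRisk.comp (hv.prodMk hP.measurable_sample)
  have hG : Measurable fun ω => centeredRisk P.loss D (P.virt N ω, P.ghost ω) :=
    hP.measurable_centeredRisk.comp (hv.prodMk hP.measurable_ghost)
  obtain ⟨hL, hK⟩ := hP.integrable_logRatio (D := D)
  -- Training sample: exponential moments are taken under the tilted measure, where the virtual
  -- output and the sample are independent.
  obtain ⟨h1, h2⟩ := integrable_and_abs_integral_le_of_lintegral_exp_le hS hLm hL hK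
    (b := R ^ 2 / (2 * n)) (fun l => by
      have h := hP.lintegral_exp_centeredRisk_le hv hP.measurable_sample
        (hP.map_refMeasure_virt_sample hsync) l
      have hexp : Measurable fun ω => ENNReal.ofReal
          (Real.exp (l * centeredRisk P.loss D (P.virt N ω, P.sample ω))) :=
        (Real.measurable_exp.comp (hS.const_mul l)).ennreal_ofReal
      rw [lintegral_withDensity_eq_lintegral_mul _ hr hexp] at h
      exact h)
  -- Ghost sample: with trivial ratio and zero entropy the same inequality gives integrability and
  -- mean zero.
  obtain ⟨h3, h4⟩ := integrable_and_abs_integral_le_of_lintegral_exp_le (μ := μ) (K := 0) hG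
    (L := fun _ => 0) measurable_const (integrable_const _) (by simp)
    (b := R ^ 2 / (2 * n)) (fun l => by
      simpa using hP.lintegral_exp_centeredRisk_le hv hP.measurable_ghost hP.map_virt_ghost l)
  rw [mul_zero, Real.sqrt_zero] at h4
  have h5 := abs_nonpos_iff.1 h4
  have e : (fun ω => empRisk P.loss (P.virt N ω) (P.ghost ω) -
      empRisk P.loss (P.virt N ω) (P.sample ω)) = fun ω =>
      centeredRisk P.loss D (P.virt N ω, P.sample ω) -
        centeredRisk P.loss D (P.virt N ω, P.ghost ω) := by
    ext ω; simp [centeredRisk]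
  rw [e]
  refine ⟨h1.sub h3, ?_⟩
  rw [integral_sub h1 h3, h5, sub_zero]
  refine h2.trans (Real.sqrt_le_sqrt ?_)
  refine mul_le_mul_of_nonneg_right ?_ (Finset.sum_nonneg fun t ht =>
    mul_nonneg (sq_nonneg _) (add_nonneg ?_ ?_))
  -- The argument yields the constant `2 R² / n`, relaxed here to `4 R² / n`.
  · rw [show 4 * ((R : ℝ) ^ 2 / (2 * n)) = 2 * (R : ℝ) ^ 2 / n by field_simp; ring]
    gcongr
    norm_num
  all_goals
    refine integral_nonneg_of_ae ?_
    filter_upwards [hP.posDef_cov t (Finset.mem_range.1 ht)] with ω hω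
    exact sqNormIn_nonneg (hω.inv.posSemidef) _

end Conditions

end VirtualSGD

/-! ### Transfer to the real output, and fixed covariances. -/

namespace VirtualSGD

variable {Ω 𝒵 : Type*} [mΩ : MeasurableSpace Ω] [MeasurableSpace 𝒵] {d n N : ℕ}
  {P : VirtualSGD Ω 𝒵 d n N} {μ : Measure Ω} {D : Measure 𝒵} {R : ℝ≥0}

lemma sqNormIn_inv_smul_one {c : ℝ} (hc : c ≠ 0) (x : Param d) :
    sqNormIn (c • (1 : Matrix (Fin d) (Fin d) ℝ))⁻¹ x = c⁻¹ * ‖x‖ ^ 2 := by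
  have h : (c • (1 : Matrix (Fin d) (Fin d) ℝ))⁻¹ = c⁻¹ • 1 :=
    Matrix.inv_eq_right_inv (by simp [smul_smul, hc])
  rw [h, sqNormIn, Matrix.smul_mulVec, Matrix.one_mulVec, dotProduct_smul, smul_eq_mul,
    EuclideanSpace.real_norm_sq_eq]
  simp [dotProduct, sq]

lemma isSyncReference_of_version (hP : P.Conditions μ D R) {t : ℕ} (ht : t < N)
    {M : Ω → Matrix (Fin d) (Fin d) ℝ} (hM : ∀ᵐ ω ∂μ, M ω = P.cov t ω)
    (h : (∃ C, M = fun _ => C) ∨ MatrixMeasurable P.aux M ∨ MatrixMeasurable (P.refField t) M) :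
    P.IsSyncReference μ t M := by
  refine ⟨?_, ?_, hM⟩
  · rcases h with ⟨C, rfl⟩ | h | h
    · exact fun i j => measurable_const
    · exact fun i j => (h i j).mono le_sup_right le_rfl
    · exact h
  · filter_upwards [hM, hP.posDef_cov t ht] with ω h1 h2
    rwa [h1]

lemma covCost_eq_zero (hP : P.Conditions μ D R) {t : ℕ} (ht : t < N)
    {M : Ω → Matrix (Fin d) (Fin d) ℝ} (hM : P.IsSyncReference μ t M) :
    P.covCost μ t M = 0 := by
  rw [covCost, integral_eq_zero_of_ae, mul_zero]
  filter_upwards [hM.eq_cov, hP.posDef_cov t ht] with ω h1 h2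
  rw [h1, Matrix.nonsing_inv_mul _ ((Matrix.isUnit_iff_isUnit_det _).1 h2.isUnit),
    div_self h2.det_pos.ne']
  simp

namespace Conditions

variable [IsProbabilityMeasure D] [IsProbabilityMeasure μ]

/-- Given `fullField 0`, the output and both samples are frozen, so the virtual gap averages to the
gap smoothed by `N(0, accCov N)`. The difference from the real gap is by definition the difference
of output sensitivities. Integrability of the real gap follows from that of the other two terms. -/
lemma integral_output (hP : P.Conditions μ D R)
    (hv : Integrable (fun ω => empRisk P.loss (P.virt N ω) (P.ghost ω) -
      empRisk P.loss (P.virt N ω) (P.sample ω)) μ) :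
    Integrable (fun ω => empRisk P.loss (P.iter N ω) (P.ghost ω) -
        empRisk P.loss (P.iter N ω) (P.sample ω)) μ ∧
      P.genError μ = ∫ ω, (outputSensitivity P.loss (P.accCov N ω) (P.iter N ω) (P.ghost ω) -
          outputSensitivity P.loss (P.accCov N ω) (P.iter N ω) (P.sample ω)) ∂μ +
        ∫ ω, (empRisk P.loss (P.virt N ω) (P.ghost ω) -
          empRisk P.loss (P.virt N ω) (P.sample ω)) ∂μ := by
  have hle := hP.fullField_le (Nat.zero_le N)
  have hW : Measurable fun ω : Coarse (P.fullField 0) => P.iter N ω :=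
    P.measurable_iter_fullField 0 le_rfl
  have hS : Measurable fun ω : Coarse (P.fullField 0) => P.sample ω :=
    P.measurable_sample_fullField 0
  have hG : Measurable fun ω : Coarse (P.fullField 0) => P.ghost ω :=
    P.measurable_ghost_fullField 0
  let F : Coarse (P.fullField 0) × Param d → ℝ := fun p =>
    empRisk P.loss (P.iter N p.1 + p.2) (P.ghost p.1) -
      empRisk P.loss (P.iter N p.1 + p.2) (P.sample p.1)
  have hadd : Measurable fun p : Coarse (P.fullField 0) × Param d => P.iter N p.1 + p.2 :=
    (hW.comp measurable_fst).add measurable_snd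
  have hF : Measurable F :=
    ((measurable_empRisk hP.measurable_loss).comp
      (hadd.prodMk (hG.comp measurable_fst))).sub
    ((measurable_empRisk hP.measurable_loss).comp (hadd.prodMk (hS.comp measurable_fst)))
  have hFv : ∀ ω, F (toCoarse _ ω, P.accNoise N ω) = empRisk P.loss (P.virt N ω) (P.ghost ω) -
      empRisk P.loss (P.virt N ω) (P.sample ω) := fun ω => by
    rw [← iter_add_accNoise]; rfl
  obtain ⟨-, h2, h3⟩ := (hP.hasCondDistrib_accNoise le_rfl).integral_toCoarse hle hF
    (by simpa only [hFv] using hv)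
  simp only [hFv] at h3
  have h2' : Integrable (fun ω => ∫ x, (empRisk P.loss (P.iter N ω + x) (P.ghost ω) -
      empRisk P.loss (P.iter N ω + x) (P.sample ω))
        ∂(multivariateGaussian 0 (P.accCov N ω))) μ := h2
  have h3' : ∫ ω, (empRisk P.loss (P.virt N ω) (P.ghost ω) -
      empRisk P.loss (P.virt N ω) (P.sample ω)) ∂μ =
      ∫ ω, ∫ x, (empRisk P.loss (P.iter N ω + x) (P.ghost ω) -
      empRisk P.loss (P.iter N ω + x) (P.sample ω))
        ∂(multivariateGaussian 0 (P.accCov N ω)) ∂μ := h3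
  have hae : (fun ω => empRisk P.loss (P.iter N ω) (P.ghost ω) -
        empRisk P.loss (P.iter N ω) (P.sample ω)) =ᵐ[μ] fun ω =>
      (outputSensitivity P.loss (P.accCov N ω) (P.iter N ω) (P.ghost ω) -
          outputSensitivity P.loss (P.accCov N ω) (P.iter N ω) (P.sample ω)) +
      ∫ x, (empRisk P.loss (P.iter N ω + x) (P.ghost ω) -
      empRisk P.loss (P.iter N ω + x) (P.sample ω))
        ∂(multivariateGaussian 0 (P.accCov N ω)) := by
    filter_upwards [hP.integrable_output_sample, hP.integrable_output_ghost] with ω hs hg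
    have hg' : Integrable (fun x => empRisk P.loss (P.iter N ω + x) (P.ghost ω))
        (multivariateGaussian 0 (P.accCov N ω)) := by
      refine ((integrable_const (empRisk P.loss (P.iter N ω) (P.ghost ω))).sub hg).congr
        (Filter.Eventually.of_forall fun x => ?_)
      simp
    have hs' : Integrable (fun x => empRisk P.loss (P.iter N ω + x) (P.sample ω))
        (multivariateGaussian 0 (P.accCov N ω)) := by
      refine ((integrable_const (empRisk P.loss (P.iter N ω) (P.sample ω))).sub hs).congr
        (Filter.Eventually.of_forall fun x => ?_)
      simp
    rw [outputSensitivity, outputSensitivity, integral_sub (integrable_const _) hg',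
      integral_sub (integrable_const _) hs', integral_sub hg' hs']
    simp only [integral_const, probReal_univ, one_smul]
    ring
  refine ⟨(hP.integrable_penalty.add h2').congr hae.symm, ?_⟩
  rw [genError, integral_congr_ae hae, integral_add hP.integrable_penalty h2', ← h3']

lemma sync_bound (hP : P.Conditions μ D R) (hsync : ∀ t < N, ∃ M, P.IsSyncReference μ t M) :
    Integrable (fun ω => empRisk P.loss (P.iter N ω) (P.ghost ω) -
        empRisk P.loss (P.iter N ω) (P.sample ω)) μ ∧
      |P.genError μ| ≤ √(4 * (R : ℝ) ^ 2 / n * ∑ t ∈ Finset.range N, P.rate t ^ 2 *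
        (∫ ω, sqNormIn (P.precision t ω) (P.stochGrad t ω - popGrad P.loss D (P.iter t ω)) ∂μ +
          ∫ ω, sqNormIn (P.precision t ω) (popGrad P.loss D (P.iter t ω + P.accNoise t ω) -
            popGrad P.loss D (P.iter t ω)) ∂μ)) + P.outputPenalty μ (P.accCov N) := by
  obtain ⟨h1, h2⟩ := hP.virtual_bound hsync
  obtain ⟨h3, h4⟩ := hP.integral_output h1
  refine ⟨h3, ?_⟩
  rw [h4, outputPenalty, add_comm (√_)]
  exact (abs_add_le _ _).trans (add_le_add_right h2 _)

lemma integral_gradDeviation_add_gradSensitivity (hP : P.Conditions μ D R) {t : ℕ} (ht : t < N) :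
    ∫ ω, (P.gradDeviation μ D (P.precision t) t ω +
        P.gradSensitivity μ D (P.precision t) t ω) ∂μ =
      ∫ ω, sqNormIn (P.precision t ω) (P.stochGrad t ω - popGrad P.loss D (P.iter t ω)) ∂μ +
        ∫ ω, sqNormIn (P.precision t ω) (popGrad P.loss D (P.iter t ω + P.accNoise t ω) -
          popGrad P.loss D (P.iter t ω)) ∂μ := by
  have hle : P.history t ⊔ P.aux ≤ mΩ := sup_le (hP.history_le ht.le) hP.aux_le
  rw [gradDeviation, gradSensitivity, integral_add integrable_condExp integrable_condExp,
    integral_condExp hle, integral_condExp hle]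

/-- With deterministic covariances the accumulated perturbation, given `fullField 0`, has a fixed
Gaussian law and acts as a fresh copy. -/
lemma integral_freshSensitivity (hP : P.Conditions μ D R) {C : ℕ → Matrix (Fin d) (Fin d) ℝ}
    (hC : ∀ t < N, ∀ᵐ ω ∂μ, P.cov t ω = C t) {t : ℕ} (ht : t < N) :
    Integrable (fun ω => freshSensitivity P.loss D (C t)⁻¹ (∑ k ∈ Finset.range t, C k)
        (P.iter t ω)) μ ∧
      ∫ ω, freshSensitivity P.loss D (C t)⁻¹ (∑ k ∈ Finset.range t, C k) (P.iter t ω) ∂μ =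
      ∫ ω, sqNormIn (P.precision t ω) (popGrad P.loss D (P.iter t ω + P.accNoise t ω) -
          popGrad P.loss D (P.iter t ω)) ∂μ := by
  have hle := hP.fullField_le (Nat.zero_le N)
  have hW : Measurable fun ω : Coarse (P.fullField 0) => P.iter t ω :=
    P.measurable_iter_fullField 0 ht.le
  let F : Coarse (P.fullField 0) × Param d → ℝ := fun p =>
    sqNormIn (C t)⁻¹ (popGrad P.loss D (P.iter t p.1 + p.2) - popGrad P.loss D (P.iter t p.1))
  have hg1 : Measurable fun p : Coarse (P.fullField 0) × Param d =>
      popGrad P.loss D (P.iter t p.1 + p.2) :=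
    hP.measurable_popGrad.comp ((hW.comp measurable_fst).add measurable_snd)
  have hg2 : Measurable fun p : Coarse (P.fullField 0) × Param d =>
      popGrad P.loss D (P.iter t p.1) := hP.measurable_popGrad.comp (hW.comp measurable_fst)
  have hF : Measurable F :=
    measurable_sqNormIn.comp ((measurable_const (a := (C t)⁻¹)).prodMk (hg1.sub hg2))
  have hprec : ∀ᵐ ω ∂μ, P.precision t ω = (C t)⁻¹ := (hC t ht).mono fun ω h => by
    rw [precision, h]
  have hFp : (fun ω => sqNormIn (P.precision t ω) (popGrad P.loss D
      (P.iter t ω + P.accNoise t ω) - popGrad P.loss D (P.iter t ω))) =ᵐ[μ]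
      fun ω => F (toCoarse _ ω, P.accNoise t ω) := hprec.mono fun ω h => by
    simp only [h]; rfl
  obtain ⟨-, h2, h3⟩ := (hP.hasCondDistrib_accNoise ht.le).integral_toCoarse hle hF
    ((hP.integrable_sensitivity t ht).congr hFp)
  have hacc : ∀ᵐ ω ∂μ, P.accCov t ω = ∑ k ∈ Finset.range t, C k := by
    have h : ∀ k ∈ Finset.range t, ∀ᵐ ω ∂μ, P.cov k ω = C k :=
      fun k hk => hC k ((Finset.mem_range.1 hk).trans ht)
    filter_upwards [(Filter.eventually_all_finset _).2 h] with ω hω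
    exact Finset.sum_congr rfl hω
  have hfr : (fun ω => ∫ x, F (toCoarse (P.fullField 0) ω, x) ∂(condGaussian (P.accCov t)
      (hP.measurable_accCov_fullField 0 ht.le)) (toCoarse _ ω)) =ᵐ[μ]
      fun ω => freshSensitivity P.loss D (C t)⁻¹ (∑ k ∈ Finset.range t, C k) (P.iter t ω) :=
    hacc.mono fun ω h => by
      simp only [freshSensitivity, ← h]
      rfl
  refine ⟨h2.congr hfr, ?_⟩
  rw [integral_congr_ae hFp, h3]
  exact (integral_congr_ae hfr).symm

/-- Constants are synchronized, so `sync_bound` applies. Conditioning on the history without the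
auxiliary field is harmless, since only the expectation of the conditional expectation enters. -/
lemma fixed_bound (hP : P.Conditions μ D R) (C : ℕ → Matrix (Fin d) (Fin d) ℝ)
    (hC : ∀ t < N, ∀ᵐ ω ∂μ, P.cov t ω = C t) :
    |P.genError μ| ≤
      √(4 * (R : ℝ) ^ 2 / n * ∑ t ∈ Finset.range N, P.rate t ^ 2 *
          ∫ ω, ((μ[fun ω' => sqNormIn (C t)⁻¹
              (P.stochGrad t ω' - popGrad P.loss D (P.iter t ω')) | P.history t]) ω +
            freshSensitivity P.loss D (C t)⁻¹ (∑ k ∈ Finset.range t, C k) (P.iter t ω)) ∂μ) +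
        P.outputPenalty μ (fun _ => ∑ k ∈ Finset.range N, C k) := by
  have hsync : ∀ t < N, ∃ M, P.IsSyncReference μ t M := fun t ht =>
    ⟨fun _ => C t, isSyncReference_of_version hP ht ((hC t ht).mono fun _ h => h.symm)
      (Or.inl ⟨C t, rfl⟩)⟩
  refine (hP.sync_bound hsync).2.trans (le_of_eq ?_)
  congr 1
  · congr 2
    refine Finset.sum_congr rfl fun t ht => ?_
    have ht' := Finset.mem_range.1 ht
    obtain ⟨h1, h2⟩ := hP.integral_freshSensitivity hC ht'
    congr 1
    rw [integral_add integrable_condExp h1, h2, integral_condExp (hP.history_le ht'.le)]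
    congr 1
    refine integral_congr_ae ((hC t ht').mono fun ω h => ?_)
    simp only [precision, h]
  · have hacc : ∀ᵐ ω ∂μ, P.accCov N ω = ∑ k ∈ Finset.range N, C k := by
      have h : ∀ k ∈ Finset.range N, ∀ᵐ ω ∂μ, P.cov k ω = C k :=
        fun k hk => hC k (Finset.mem_range.1 hk)
      filter_upwards [(Filter.eventually_all_finset _).2 h] with ω hω
      exact Finset.sum_congr rfl hω
    rw [outputPenalty, outputPenalty]
    congr 1
    exact integral_congr_ae (hacc.mono fun ω h => by simp only [h])

lemma isotropic_bound (hP : P.Conditions μ D R) (σ : ℕ → ℝ) (hσ : ∀ t < N, 0 < σ t)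
    (hC : ∀ t < N, ∀ᵐ ω ∂μ, P.cov t ω = σ t ^ 2 • (1 : Matrix (Fin d) (Fin d) ℝ)) :
    |P.genError μ| ≤
      √(4 * (R : ℝ) ^ 2 / n * ∑ t ∈ Finset.range N, P.rate t ^ 2 / σ t ^ 2 *
          ∫ ω, ((μ[fun ω' => ‖P.stochGrad t ω' - popGrad P.loss D (P.iter t ω')‖ ^ 2 |
              P.history t]) ω +
            ∫ x, ‖popGrad P.loss D (P.iter t ω + x) - popGrad P.loss D (P.iter t ω)‖ ^ 2
              ∂(multivariateGaussian 0
                ((∑ k ∈ Finset.range t, σ k ^ 2) • (1 : Matrix (Fin d) (Fin d) ℝ)))) ∂μ) +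
        P.outputPenalty μ (fun _ =>
          (∑ k ∈ Finset.range N, σ k ^ 2) • (1 : Matrix (Fin d) (Fin d) ℝ)) := by
  refine (hP.fixed_bound (fun t => σ t ^ 2 • 1) hC).trans (le_of_eq ?_)
  simp only [Finset.sum_smul]
  congr 3
  refine Finset.sum_congr rfl fun t ht => ?_
  have hne : σ t ^ 2 ≠ 0 := (pow_pos (hσ t (Finset.mem_range.1 ht)) 2).ne'
  rw [div_mul_eq_mul_div, mul_div_assoc]
  congr 1
  rw [div_eq_inv_mul, ← integral_const_mul]
  refine integral_congr_ae ?_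
  have h := condExp_smul (μ := μ) (σ t ^ 2)⁻¹
    (fun ω' => ‖P.stochGrad t ω' - popGrad P.loss D (P.iter t ω')‖ ^ 2) (P.history t)
  have e : (fun ω' => sqNormIn (σ t ^ 2 • (1 : Matrix (Fin d) (Fin d) ℝ))⁻¹
      (P.stochGrad t ω' - popGrad P.loss D (P.iter t ω'))) = (σ t ^ 2)⁻¹ •
      fun ω' => ‖P.stochGrad t ω' - popGrad P.loss D (P.iter t ω')‖ ^ 2 := by
    ext ω'
    exact sqNormIn_inv_smul_one hne _
  filter_upwards [h] with ω hω
  rw [e, hω, mul_add]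
  simp only [freshSensitivity, sqNormIn_inv_smul_one hne, integral_const_mul]
  rfl

end Conditions

end VirtualSGD

theorem mainTheorem2 {Ω 𝒵 : Type*} [MeasurableSpace Ω] [MeasurableSpace 𝒵]
    (μ : Measure Ω) [IsProbabilityMeasure μ] (D : Measure 𝒵) [IsProbabilityMeasure D]
    {d n N : ℕ} (P : VirtualSGD Ω 𝒵 d n N) (R : ℝ≥0) (hP : P.Conditions μ D R) :
    -- the synchronized bound
    ((∀ t < N, ∃ M, P.IsSyncReference μ t M) →
      (∀ t < N, ∀ M, P.IsSyncReference μ t M →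
        P.covCost μ t M = 0 ∧ ∀ᵐ ω ∂μ, (M ω)⁻¹ = (P.cov t ω)⁻¹) ∧
      Integrable (fun ω => empRisk P.loss (P.iter N ω) (P.ghost ω) -
        empRisk P.loss (P.iter N ω) (P.sample ω)) μ ∧
      |P.genError μ| ≤
        √(4 * (R : ℝ) ^ 2 / n * ∑ t ∈ Finset.range N, P.rate t ^ 2 *
            ∫ ω, (P.gradDeviation μ D (P.precision t) t ω +
              P.gradSensitivity μ D (P.precision t) t ω) ∂μ) +
          P.outputPenalty μ (P.accCov N)) ∧
    -- deterministic, public and prefix-observable covariances have a certificate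
    (∀ t < N, ∀ M : Ω → Matrix (Fin d) (Fin d) ℝ, (∀ᵐ ω ∂μ, M ω = P.cov t ω) →
      ((∃ C, M = fun _ => C) ∨ MatrixMeasurable P.aux M ∨ MatrixMeasurable (P.refField t) M) →
      P.IsSyncReference μ t M) ∧
    -- the bound for fixed geometry-aware perturbations
    (∀ C : ℕ → Matrix (Fin d) (Fin d) ℝ, (∀ t < N, ∀ᵐ ω ∂μ, P.cov t ω = C t) →
      |P.genError μ| ≤
        √(4 * (R : ℝ) ^ 2 / n * ∑ t ∈ Finset.range N, P.rate t ^ 2 *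
            ∫ ω, ((μ[fun ω' => sqNormIn (C t)⁻¹
                (P.stochGrad t ω' - popGrad P.loss D (P.iter t ω')) | P.history t]) ω +
              freshSensitivity P.loss D (C t)⁻¹ (∑ k ∈ Finset.range t, C k) (P.iter t ω)) ∂μ) +
          P.outputPenalty μ (fun _ => ∑ k ∈ Finset.range N, C k)) ∧
    -- the bound for fixed isotropic perturbations
    (∀ σ : ℕ → ℝ, (∀ t < N, 0 < σ t) →
      (∀ t < N, ∀ᵐ ω ∂μ, P.cov t ω = σ t ^ 2 • (1 : Matrix (Fin d) (Fin d) ℝ)) →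
      |P.genError μ| ≤
        √(4 * (R : ℝ) ^ 2 / n * ∑ t ∈ Finset.range N, P.rate t ^ 2 / σ t ^ 2 *
            ∫ ω, ((μ[fun ω' => ‖P.stochGrad t ω' - popGrad P.loss D (P.iter t ω')‖ ^ 2 |
                P.history t]) ω +
              ∫ x, ‖popGrad P.loss D (P.iter t ω + x) - popGrad P.loss D (P.iter t ω)‖ ^ 2
                ∂(multivariateGaussian 0
                  ((∑ k ∈ Finset.range t, σ k ^ 2) • (1 : Matrix (Fin d) (Fin d) ℝ)))) ∂μ) +
          P.outputPenalty μ (fun _ =>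
            (∑ k ∈ Finset.range N, σ k ^ 2) • (1 : Matrix (Fin d) (Fin d) ℝ))) := by
  refine ⟨fun hsync => ⟨fun t ht M hM => ⟨VirtualSGD.covCost_eq_zero hP ht hM, ?_⟩, ?_⟩,
    fun t ht M hM h => VirtualSGD.isSyncReference_of_version hP ht hM h,
    fun C hC => hP.fixed_bound C hC, fun σ hσ hC => hP.isotropic_bound σ hσ hC⟩
  · filter_upwards [hM.eq_cov] with ω h
    rw [h]
  · obtain ⟨h1, h2⟩ := hP.sync_bound hsync
    refine ⟨h1, h2.trans (le_of_eq ?_)⟩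
    congr 3
    refine Finset.sum_congr rfl fun t ht => ?_
    rw [hP.integral_gradDeviation_add_gradSensitivity (Finset.mem_range.1 ht)]
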